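/- Let $\mathcal Y$ be the junction of three half-lines $E_j=(0,\infty)$, $j=1,2,3$, joined at the common vertex $0$; let $c_1,c_2,c_3>0$ and $\lambda\in\mathbb R$. Functions are real-valued, $L^2(\mathcal Y)=\bigoplus_{j=1}^3L^2(0,\infty)$, and $H^m(\mathcal Y)=\bigoplus_{j=1}^3H^m(0,\infty)$. Let $\mathcal T_\lambda u=(-c_j^2u_j'')_{j=1}^3$ with domain $$D(\mathcal T_\lambda)=\Big\{u\in H^2(\mathcal Y):\ c_1u_1'(0+)=c_2u_2'(0+)=c_3u_3'(0+),\ \ \sum_{j=1}^3c_ju_j(0+)=\lambda c_1u_1'(0+)\Big\}$$ ($\delta'$-conditions), let $\mathcal A(u,v)=(v,-\mathcal T_\lambda u)$ with $D(\mathcal A)=D(\mathcal T_\lambda)\times H^1(\mathcal Y)$, and $F(u,v)=(0,(-\sin u_j)_{j=1}^3)$. A solution on $[0,T]$ of the sine-Gordon system $\mathbf w_t=\mathcal A\mathbf w+F(\mathbf w)$ with $\mathbf w(0)=\Psi$ is a function $\mathbf w\in C([0,T];H^1(\mathcal Y)\times L^2(\mathcal Y))$ with $\mathbf w(0)=\Psi$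 such that, for all $t\in[0,T]$, $\int_0^t\mathbf w(s)\,ds\in D(\mathcal A)$ and $$\mathbf w(t)=\Psi+\mathcal A\int_0^t\mathbf w(s)\,ds+\int_0^tF(\mathbf w(s))\,ds .$$ Put $X_\lambda=H^1(\mathcal Y)\times L^2(\mathcal Y)$ if $\lambda\neq0$, and $X_0=\{(u,v)\in H^1(\mathcal Y)\times L^2(\mathcal Y):\sum_{j=1}^3c_ju_j(0+)=0\}$. Then for every $\Psi\in X_\lambda$ there exists $T>0$ such that the sine-Gordon system has a unique solution $\mathbf w\in C([0,T];H^1(\mathcal Y)\times L^2(\mathcal Y))$ with $\mathbf w(0)=\Psi$. Moreover, for each $T_0\in(0,T)$, every $\Phi\in X_\lambda$ is the initial datum of a unique solution on $[0,T_0]$, and the data-to-solution map $X_\lambda\to C([0,T_0];H^1(\mathcal Y)\times L^2(\mathcal Y))$ is of class $C^2$. -/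

import Mathlib

open MeasureTheory Set Filter Topology
open scoped ContDiff ENNReal

noncomputable section

namespace Tricrystal

/-- The real Hilbert space `L²(0, ∞)`. -/
abbrev L2Half : Type := Lp ℝ 2 (volume.restrict (Ioi (0 : ℝ)))

/-- `φ` is a test function on the open half-line `(0, ∞)`. -/
def IsTest (φ : ℝ → ℝ) : Prop :=
  ContDiff ℝ ∞ φ ∧ HasCompactSupport φ ∧ tsupport φ ⊆ Ioi 0

/-- `g ∈ L²(0, ∞)` is the weak derivative of `f ∈ L²(0, ∞)` on `(0, ∞)`. -/
def HasWeakDeriv (f g : L2Half) : Prop :=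
  ∀ φ : ℝ → ℝ, IsTest φ →
    ∫ x in Ioi (0 : ℝ), f x * deriv φ x = -∫ x in Ioi (0 : ℝ), g x * φ x

theorem IsTest.memLp {φ : ℝ → ℝ} (h : IsTest φ) :
    MemLp φ 2 (volume.restrict (Ioi (0 : ℝ))) :=
  (h.1.continuous.memLp_of_hasCompactSupport h.2.1).restrict _

theorem IsTest.memLp_deriv {φ : ℝ → ℝ} (h : IsTest φ) :
    MemLp (deriv φ) 2 (volume.restrict (Ioi (0 : ℝ))) :=
  ((h.1.continuous_deriv (by simp)).memLp_of_hasCompactSupport h.2.1.deriv).restrict _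

theorem integral_eq_inner {φ : ℝ → ℝ} (h : MemLp φ 2 (volume.restrict (Ioi (0 : ℝ))))
    (f : L2Half) : ∫ x in Ioi (0 : ℝ), f x * φ x = inner ℝ (h.toLp φ) f := by
  rw [L2.inner_def]
  refine integral_congr_ae ?_
  filter_upwards [h.coeFn_toLp] with x hx
  simp [hx]

theorem hasWeakDeriv_iff (f g : L2Half) :
    HasWeakDeriv f g ↔ ∀ (φ : ℝ → ℝ) (h : IsTest φ),
      inner ℝ (h.memLp_deriv.toLp (deriv φ)) f + inner ℝ (h.memLp.toLp φ) g = 0 := by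
  unfold HasWeakDeriv
  refine forall_congr' fun φ => forall_congr' fun h => ?_
  rw [integral_eq_inner h.memLp_deriv f, integral_eq_inner h.memLp g, eq_neg_iff_add_eq_zero]

/-- The Sobolev space `H¹(0, ∞)`: a function `f ∈ L²(0, ∞)` with a weak derivative `f' ∈ L²(0, ∞)`
is recorded as the pair `(f, f')`, so that the norm inherited from `L² × L²` is the usual one,
`‖f‖² + ‖f'‖²` being its square. -/
def H1Half : Submodule ℝ (WithLp 2 (L2Half × L2Half)) where
  carrier := {p | HasWeakDeriv p.fst p.snd}
  zero_mem' := by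
    simp only [mem_ofPred_eq, hasWeakDeriv_iff]
    intro φ h
    simp
  add_mem' := by
    intro p q hp hq
    simp only [mem_ofPred_eq, hasWeakDeriv_iff] at hp hq ⊢
    intro φ h
    have h1 := hp φ h
    have h2 := hq φ h
    simp only [WithLp.add_fst, WithLp.add_snd, inner_add_right]
    linarith
  smul_mem' := by
    intro a p hp
    simp only [mem_ofPred_eq, hasWeakDeriv_iff] at hp ⊢
    intro φ h
    have h1 := hp φ h
    simp only [WithLp.smul_fst, WithLp.smul_snd, inner_smul_right]
    rw [← mul_add, h1, mul_zero]

theorem isClosed_H1Half : IsClosed (H1Half : Set (WithLp 2 (L2Half × L2Half))) := by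
  have : (H1Half : Set (WithLp 2 (L2Half × L2Half))) =
      ⋂ (φ : ℝ → ℝ) (h : IsTest φ), {p : WithLp 2 (L2Half × L2Half) |
        inner ℝ (h.memLp_deriv.toLp (deriv φ)) p.fst + inner ℝ (h.memLp.toLp φ) p.snd = 0} := by
    ext p
    simp only [mem_iInter, mem_ofPred_eq]
    exact hasWeakDeriv_iff p.fst p.snd
  rw [this]
  refine isClosed_iInter fun φ => isClosed_iInter fun h => isClosed_eq ?_ continuous_const
  have h1 : Continuous fun p : WithLp 2 (L2Half × L2Half) => p.fst :=
    continuous_fst.comp (WithLp.prod_continuous_ofLp 2 L2Half L2Half)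
  have h2 : Continuous fun p : WithLp 2 (L2Half × L2Half) => p.snd :=
    continuous_snd.comp (WithLp.prod_continuous_ofLp 2 L2Half L2Half)
  exact (continuous_const.inner h1).add (continuous_const.inner h2)

instance : CompleteSpace H1Half := isClosed_H1Half.completeSpace_coe

/-- The element of `L²(0, ∞)` underlying an element of `H¹(0, ∞)`. -/
def fn (u : H1Half) : L2Half := (u : WithLp 2 (L2Half × L2Half)).fst

/-- The weak derivative of an element of `H¹(0, ∞)`. -/
def der (u : H1Half) : L2Half := (u : WithLp 2 (L2Half × L2Half)).snd

/-- `f(0+) = a`: some representative of `f` has the limit `a` at `0` from the right. -/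
def HasTrace (f : L2Half) (a : ℝ) : Prop :=
  ∃ g : ℝ → ℝ, f =ᵐ[volume.restrict (Ioi (0 : ℝ))] g ∧ Tendsto g (𝓝[>] 0) (𝓝 a)

/-- `L²(𝒴) = L²(0, ∞) ⊕ L²(0, ∞) ⊕ L²(0, ∞)`. -/
abbrev L2Y : Type := PiLp 2 (fun _ : Fin 3 => L2Half)

/-- `H¹(𝒴) = H¹(0, ∞) ⊕ H¹(0, ∞) ⊕ H¹(0, ∞)`. -/
abbrev H1Y : Type := PiLp 2 (fun _ : Fin 3 => H1Half)

/-- `H¹(𝒴) × L²(𝒴)`. -/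
abbrev Phase : Type := WithLp 2 (H1Y × L2Y)

/-- The `δ'`-conditions at the vertex for a function on `𝒴` with components `u j` and component
derivatives `u' j`:
`c₁ u₁'(0+) = c₂ u₂'(0+) = c₃ u₃'(0+)` and `∑ⱼ cⱼ uⱼ(0+) = lam c₁ u₁'(0+)`. -/
def DeltaPrime (c : Fin 3 → ℝ) (lam : ℝ) (u u' : Fin 3 → L2Half) : Prop :=
  ∃ a b : Fin 3 → ℝ, (∀ j, HasTrace (u j) (a j)) ∧ (∀ j, HasTrace (u' j) (b j)) ∧
    c 0 * b 0 = c 1 * b 1 ∧ c 1 * b 1 = c 2 * b 2 ∧ ∑ j, c j * a j = lam * (c 0 * b 0)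

/-- The graph of the self-adjoint operator `𝒯 = diag(-cⱼ² d²/dx²)` with `δ'`-conditions:
`u` lies in its domain, i.e. `u ∈ H²(𝒴)` (each `uⱼ'` has a weak derivative `uⱼ'' ∈ L²`) and `u`
satisfies the `δ'`-conditions, and `𝒯 u = f`. -/
def GraphT (c : Fin 3 → ℝ) (lam : ℝ) (u : H1Y) (f : L2Y) : Prop :=
  (∃ u'' : Fin 3 → L2Half, ∀ j, HasWeakDeriv (der (u j)) (u'' j) ∧ f j = -(c j ^ 2 • u'' j)) ∧
    DeltaPrime c lam (fun j => fn (u j)) (fun j => der (u j))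

/-- The graph of the operator `J E : (u, v) ↦ (v, -𝒯 u)` in `H¹(𝒴) × L²(𝒴)`, with domain
`D(𝒯) × H¹(𝒴)`: here `w = (u, v)` lies in the domain and `z = J E w`. (The first component of `z`
is an element of `H¹(𝒴)` whose underlying `L²` function is `v`, so `v ∈ H¹(𝒴)`.) -/
def GraphJE (c : Fin 3 → ℝ) (lam : ℝ) (w z : Phase) : Prop :=
  (∀ j, fn (z.fst j) = w.snd j) ∧ GraphT c lam w.fst (-z.snd)

theorem lipschitzWith_sin : LipschitzWith 1 Real.sin :=
  lipschitzWith_of_nnnorm_deriv_le Real.differentiable_sin fun x => by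
    rw [← NNReal.coe_le_coe]
    simpa using Real.abs_cos_le_one x

/-- The nonlinearity `F(u, v) = (0, -sin u)`, where `sin u` is the composition `sin ∘ u` in each
component. -/
def nonlin (w : Phase) : Phase :=
  WithLp.toLp 2 (0, WithLp.toLp 2 fun j => -(lipschitzWith_sin.compLp Real.sin_zero (fn (w.fst j))))

/-- `w ∈ C([0, T]; H¹(𝒴) × L²(𝒴))` is a (mild) solution of `w_t = J E w + F(w)`, `w(0) = Ψ`:
for every `t ∈ [0, T]` the integral `∫₀ᵗ w` lies in the domain of `J E` and
`w(t) = Ψ + J E ∫₀ᵗ w(s) ds + ∫₀ᵗ F(w(s)) ds`. (`IccExtend` only extends `w` to all real times;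
its values outside `[0, T]` play no role.) -/
def IsSolution (c : Fin 3 → ℝ) (lam : ℝ) {T : ℝ} (hT : 0 ≤ T) (Ψ : Phase)
    (w : C(Icc (0 : ℝ) T, Phase)) : Prop :=
  w ⟨0, left_mem_Icc.2 hT⟩ = Ψ ∧
    ∀ t : Icc (0 : ℝ) T,
      GraphJE c lam (∫ s in (0 : ℝ)..t, IccExtend hT w s)
        (w t - Ψ - ∫ s in (0 : ℝ)..t, nonlin (IccExtend hT w s))

theorem HasTrace.add {f g : L2Half} {a b : ℝ} (hf : HasTrace f a) (hg : HasTrace g b) :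
    HasTrace (f + g) (a + b) := by
  obtain ⟨f', hf, hf'⟩ := hf
  obtain ⟨g', hg, hg'⟩ := hg
  exact ⟨f' + g', (Lp.coeFn_add f g).trans (hf.add hg), hf'.add hg'⟩

theorem HasTrace.smul {f : L2Half} {a : ℝ} (r : ℝ) (hf : HasTrace f a) :
    HasTrace (r • f) (r * a) := by
  obtain ⟨f', hf, hf'⟩ := hf
  exact ⟨r • f', (Lp.coeFn_smul r f).trans (hf.const_smul r), hf'.const_mul r⟩

theorem hasTrace_zero : HasTrace 0 0 :=
  ⟨0, Lp.coeFn_zero ℝ 2 _, tendsto_const_nhds⟩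

/-- The space of admissible initial data `(u, v)`: all of `H¹(𝒴) × L²(𝒴)` if `lam ≠ 0`, and those
elements of it that satisfy `∑ⱼ cⱼ uⱼ(0+) = 0` if `lam = 0` (a condition which does not involve
derivatives, hence is stable under limits in `H¹(𝒴)`). -/
def dataSpace (c : Fin 3 → ℝ) (lam : ℝ) : Submodule ℝ Phase where
  carrier := {w | lam = 0 →
    ∃ a : Fin 3 → ℝ, (∀ j, HasTrace (fn (w.fst j)) (a j)) ∧ ∑ j, c j * a j = 0}
  zero_mem' := fun _ => ⟨0, fun _ => hasTrace_zero, by simp⟩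
  add_mem' := by
    intro p q hp hq h
    obtain ⟨a, ha, ha'⟩ := hp h
    obtain ⟨b, hb, hb'⟩ := hq h
    refine ⟨a + b, fun j => (ha j).add (hb j), ?_⟩
    simp only [Pi.add_apply, mul_add, Finset.sum_add_distrib, ha', hb', add_zero]
  smul_mem' := by
    intro r p hp h
    obtain ⟨a, ha, ha'⟩ := hp h
    refine ⟨fun j => r * a j, fun j => (ha j).smul r, ?_⟩
    simp only [mul_left_comm _ r, ← Finset.mul_sum, ha', mul_zero]

theorem dataSpace_eq_top (c : Fin 3 → ℝ) {lam : ℝ} (h : lam ≠ 0) : dataSpace c lam = ⊤ :=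
  eq_top_iff.2 fun _ _ h0 => absurd h0 h

end Tricrystal

end

/-!
The sine-Gordon system is a semilinear wave equation, and the proof reduces it to the theory of
Lipschitz and `C²` perturbations of a contraction semigroup on a Hilbert space.

The operator `𝒯` need not be positive, but `𝒯 + M` is, if `M` is large (`shift`): its quadratic
form

  `∑ⱼ (cⱼ² ‖uⱼ'‖² + M ‖uⱼ‖²) + lam⁻¹ (∑ⱼ cⱼ uⱼ(0+))²`

is coercive on `H¹(𝒴)`, because traces are bounded by an arbitrarily small part of the Dirichlet
integral (`rep_sq_le`, `ellForm_coercive`). For `lam = 0` Lean's convention `lam⁻¹ = 0` removes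
the vertex term; this is the right form, as it is then used on the subspace `∑ⱼ cⱼ uⱼ(0+) = 0`
only. Added to `‖v‖²` it gives an inner product `energy`, equivalent to the original one on
`dataSpace`. In it the shifted wave operator `(u, v) ↦ (v, -(𝒯 + M) u)` is skew-symmetric
(`energy_waveGraph`), and the identity minus `ε` times it is onto: by Lax-Milgram the equation has
a weak solution, and the `δ'`-conditions are the natural boundary conditions of the form
(`exists_elliptic_solution`). Hence the shifted operator is maximal dissipative
(`isMDissipative_waveGraph`).

Mathlib has no theorem on the generation of semigroups, so the flow is built here for any maximal
dissipative operator `G`, viewed as a linear relation: the flows of the Yosida approximations of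
`G` converge by an energy estimate, on the domain of `G` first, then on its closure, the whole
space (`IsMDissipative.exists_flow`). The limit solves the equation in the integrated form
`w(t) - x = G ∫₀ᵗ w`, since `G` is closed. Duhamel's formula and Fubini's theorem give the
solution `Γ x + K f` with a forcing term `f` (`IsMDissipative.exists_duhamel`), and uniqueness is
the energy estimate for the primitive (`IsMDissipative.eq_zero_of_primitive_mem`).

A solution for the nonlinearity `N` is therefore a solution of `w - K (N ∘ w) = Γ x`. On a short
time interval, whose length does not depend on the data as `N` is globally Lipschitz, the left
side is a contractive perturbation of the identity of `C([0, T₀]; X)`. It is `C²` if `N` is, so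
its inverse is `C²` as well, by the inverse function theorem
(`IsMDissipative.exists_semilinear_flow`).

The term `M u`, which the shift has introduced, is returned to the nonlinearity. The map
`u ↦ sin u` is not Fréchet differentiable from `L²` to `L²`, but it is of class `C²` from `H¹` to
`L²`: by the embedding of `H¹(0, ∞)` into the bounded continuous functions (`repL`), its
derivative at `u`, the multiplication by `cos u`, is a continuously differentiable function of `u`
(`contDiff_sinOp`).

Finally, for `lam = 0` a solution is required to take its values in `H¹(𝒴) × L²(𝒴)` only. It stays
in `dataSpace` all the same, as its integrals belong to the domain of the operator
(`IsSolution.exists_incl_comp_eq`), so that uniqueness holds among all solutions.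
-/

open scoped NNReal

noncomputable section

namespace Tricrystal

/-! ### Maximal dissipative linear relations -/

/-- A maximal dissipative linear relation `G` on a Hilbert space `X`: dissipativity is measured
in the inner product `B`, which is equivalent to the given one, and `1 - ε G` is surjective for all
`ε > 0`. The relation is viewed as the graph of an unbounded operator. -/
structure IsMDissipative {X : Type*} [NormedAddCommGroup X] [InnerProductSpace ℝ X]
    (B : X →L[ℝ] X →L[ℝ] ℝ) (G : Submodule ℝ (X × X)) : Prop where
  symm : ∀ x y, B x y = B y x
  coercive : IsCoercive B
  dissip : ∀ p ∈ G, B p.1 p.2 ≤ 0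
  range : ∀ ε : ℝ, 0 < ε → ∀ z, ∃ p ∈ G, p.1 - ε • p.2 = z
  singleValued : ∀ y, ((0 : X), y) ∈ G → y = 0

namespace IsMDissipative

variable {X : Type*} [NormedAddCommGroup X] [InnerProductSpace ℝ X]
  {B : X →L[ℝ] X →L[ℝ] ℝ} {G : Submodule ℝ (X × X)}

theorem form_nonneg (h : IsMDissipative B G) (x : X) : 0 ≤ B x x := by
  obtain ⟨m, hm, hB⟩ := h.coercive
  exact le_trans (by positivity) (hB x)

theorem form_eq_zero (h : IsMDissipative B G) {x : X} (hx : B x x ≤ 0) : x = 0 := by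
  obtain ⟨m, hm, hB⟩ := h.coercive
  have h1 : m * (‖x‖ * ‖x‖) ≤ 0 := by rw [← mul_assoc]; exact (hB x).trans hx
  have h2 : ‖x‖ * ‖x‖ ≤ 0 := nonpos_of_mul_nonpos_right h1 hm
  exact norm_eq_zero.1 (mul_self_eq_zero.1 (le_antisymm h2 (mul_self_nonneg _)))

theorem form_le_norm_sq (B : X →L[ℝ] X →L[ℝ] ℝ) (x y : X) : B x y ≤ ‖B‖ * ‖x‖ * ‖y‖ :=
  (le_abs_self _).trans (B.le_opNorm₂ x y)

/-- An estimate in the energy norm is an estimate in the norm of `X`, up to a constant. -/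
theorem exists_norm_bound (h : IsMDissipative B G) :
    ∃ M : ℝ, 0 < M ∧ ∀ x z : X, B x x ≤ B z z → ‖x‖ ≤ M * ‖z‖ := by
  obtain ⟨m, hm, hB⟩ := h.coercive
  refine ⟨√(‖B‖ / m) + 1, by positivity, fun x z hxz => ?_⟩
  have h1 : ‖x‖ ^ 2 ≤ (√(‖B‖ / m) * ‖z‖) ^ 2 := by
    rw [mul_pow, Real.sq_sqrt (by positivity), div_mul_eq_mul_div, le_div_iff₀ hm]
    calc ‖x‖ ^ 2 * m = m * ‖x‖ * ‖x‖ := by ring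
      _ ≤ B x x := hB x
      _ ≤ B z z := hxz
      _ ≤ ‖B‖ * ‖z‖ * ‖z‖ := form_le_norm_sq B z z
      _ = ‖B‖ * ‖z‖ ^ 2 := by ring
  have h2 := (sq_le_sq₀ (norm_nonneg x) (by positivity)).1 h1
  nlinarith [norm_nonneg z]

/-- Growth of the energy `B u u` along a curve, from a bound on half its derivative `B u u'`. -/
theorem form_growth (h : IsMDissipative B G) {u u' : ℝ → X} {T K : ℝ}
    (hu : ContinuousOn u (Icc 0 T)) (hd : ∀ t ∈ Ioo 0 T, HasDerivAt u (u' t) t)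
    (hK : ∀ t ∈ Ioo 0 T, B (u t) (u' t) ≤ K) {t : ℝ} (ht : t ∈ Icc 0 T) :
    B (u t) (u t) ≤ B (u 0) (u 0) + 2 * K * t := by
  have hder : ∀ s ∈ Ioo 0 T,
      HasDerivAt (fun s => B (u s) (u s) - 2 * K * s) (2 * B (u s) (u' s) - 2 * K) s := by
    intro s hs
    have h1 := (B.hasFDerivAt.comp_hasDerivAt s (hd s hs)).clm_apply (hd s hs)
    have h2 := h1.sub ((hasDerivAt_id s).const_mul (2 * K))
    refine (h2.congr_deriv ?_)
    rw [Function.comp_apply, h.symm (u' s) (u s)]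
    ring
  have hanti : AntitoneOn (fun s => B (u s) (u s) - 2 * K * s) (Icc 0 T) := by
    refine antitoneOn_of_deriv_nonpos (convex_Icc 0 T) ?_ ?_ ?_
    · exact ((B.continuous.comp_continuousOn hu).clm_apply hu).sub (by fun_prop)
    · rw [interior_Icc]
      exact fun s hs => (hder s hs).differentiableAt.differentiableWithinAt
    · rw [interior_Icc]
      intro s hs
      rw [(hder s hs).deriv]
      linarith [hK s hs]
  have h0 : (0 : ℝ) ∈ Icc 0 T := ⟨le_rfl, ht.1.trans ht.2⟩
  have := hanti h0 ht ht.1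
  simp only [mul_zero, sub_zero] at this
  linarith

theorem eq_of_sub_smul_eq (h : IsMDissipative B G) {ε : ℝ} (hε : 0 < ε) {p q : X × X}
    (hp : p ∈ G) (hq : q ∈ G) (hpq : p.1 - ε • p.2 = q.1 - ε • q.2) : p = q := by
  have h1 : (p - q).1 = ε • (p - q).2 := by
    rw [Prod.fst_sub, Prod.snd_sub, smul_sub]
    rw [sub_eq_sub_iff_add_eq_add] at hpq ⊢
    rw [hpq, add_comm]
  have h2 := h.dissip _ (G.sub_mem hp hq)
  rw [h1, map_smul, smul_apply, smul_eq_mul] at h2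
  have h3 : (p - q).2 = 0 := h.form_eq_zero (nonpos_of_mul_nonpos_right h2 hε)
  have h4 : (p - q).1 = 0 := by rw [h1, h3, smul_zero]
  exact sub_eq_zero.1 (Prod.ext h4 h3)

/-- The resolvent `p.1 - ε • p.2 ↦ p.1` is a contraction in the energy norm. -/
theorem form_le_form_sub (h : IsMDissipative B G) {ε : ℝ} (hε : 0 < ε) {p : X × X} (hp : p ∈ G) :
    B p.1 p.1 ≤ B (p.1 - ε • p.2) (p.1 - ε • p.2) := by
  have h1 := h.dissip p hp
  have h2 := h.form_nonneg p.2
  simp only [map_sub, map_smul, sub_apply, smul_apply,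
    smul_eq_mul, h.symm p.2 p.1]
  nlinarith [mul_nonneg (sq_nonneg ε) h2, mul_nonneg hε.le (neg_nonneg.2 h1)]

/-- The resolvent `J = (1 - ε G)⁻¹` is a bounded operator. -/
theorem exists_resolvent (h : IsMDissipative B G) {ε : ℝ} (hε : 0 < ε) :
    ∃ J : X →L[ℝ] X, (∀ z, (J z, ε⁻¹ • (J z - z)) ∈ G) ∧
      ∀ p ∈ G, J (p.1 - ε • p.2) = p.1 := by
  choose P hPG hP using h.range ε hε
  have huniq : ∀ p ∈ G, ∀ z, p.1 - ε • p.2 = z → P z = p := fun p hp z hz =>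
    h.eq_of_sub_smul_eq hε (hPG z) hp ((hP z).trans hz.symm)
  obtain ⟨M, hM, hb⟩ := h.exists_norm_bound
  let L : X →ₗ[ℝ] X :=
    { toFun := fun z => (P z).1
      map_add' := fun a b => by
        rw [huniq (P a + P b) (G.add_mem (hPG a) (hPG b)) (a + b), Prod.fst_add]
        nth_rewrite 3 [← hP a]
        nth_rewrite 3 [← hP b]
        rw [Prod.fst_add, Prod.snd_add, smul_add]
        abel
      map_smul' := fun r a => by
        rw [huniq (r • P a) (G.smul_mem r (hPG a)) (r • a), Prod.smul_fst, RingHom.id_apply]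
        nth_rewrite 3 [← hP a]
        rw [Prod.smul_fst, Prod.smul_snd, smul_sub, smul_comm] }
  refine ⟨L.mkContinuous M fun z => hb _ _ ?_, fun z => ?_, fun p hp => ?_⟩
  · have := h.form_le_form_sub hε (hPG z)
    rwa [hP] at this
  · have h1 : ε⁻¹ • ((P z).1 - z) = (P z).2 := by
      nth_rewrite 2 [← hP z]
      rw [sub_sub_cancel, inv_smul_smul₀ hε.ne']
    change ((P z).1, ε⁻¹ • ((P z).1 - z)) ∈ G
    rw [h1]
    exact hPG z
  · change (P _).1 = p.1
    rw [huniq p hp _ rfl]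

/-- `G` is determined by its bounded resolvent, hence closed. -/
theorem isClosed (h : IsMDissipative B G) : IsClosed (G : Set (X × X)) := by
  obtain ⟨J, hJ1, hJ2⟩ := h.exists_resolvent one_pos
  have : (G : Set (X × X)) = {p | J (p.1 - (1 : ℝ) • p.2) = p.1} := by
    ext p
    refine ⟨fun hp => hJ2 p hp, fun hp => ?_⟩
    have h1 := hJ1 (p.1 - (1 : ℝ) • p.2)
    rw [mem_ofPred_eq] at hp
    rw [hp] at h1
    simpa using h1
  rw [this]
  exact isClosed_eq (by fun_prop) (by fun_prop)

/-- The domain is dense: a functional `B y` that annihilates it annihilates `x = (1 - G)⁻¹ y`,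
so `B x x = B (x - y) x ≤ 0`. -/
theorem dense_domain [CompleteSpace X] (h : IsMDissipative B G) :
    Dense {x : X | ∃ y, (x, y) ∈ G} := by
  let D : Submodule ℝ X := G.map (LinearMap.fst ℝ X X)
  have hD : {x : X | ∃ y, (x, y) ∈ G} = (D : Set X) := by
    ext x
    simp [D]
  rw [hD, Submodule.dense_iff_topologicalClosure_eq_top,
    Submodule.topologicalClosure_eq_top_iff, Submodule.eq_bot_iff]
  intro z hz
  set e := h.coercive.continuousLinearEquivOfBilin
  have hy : ∀ w, B (e.symm z) w = inner ℝ z w := fun w => by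
    rw [← h.coercive.continuousLinearEquivOfBilin_apply]
    simp [e]
  suffices e.symm z = 0 by simpa using this
  set y := e.symm z
  obtain ⟨p, hp, hpy⟩ := h.range 1 one_pos y
  rw [one_smul] at hpy
  have h0 : B y p.1 = 0 := by
    rw [hy, real_inner_comm]
    exact (Submodule.mem_orthogonal D z).1 hz p.1 ⟨p, hp, rfl⟩
  have h1 : p.1 = 0 := by
    refine h.form_eq_zero ?_
    have h2 := h.dissip p hp
    have h3 : p.1 = p.2 + y := by rw [← hpy]; abel
    calc B p.1 p.1 = B (p.2 + y) p.1 := by rw [← h3]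
      _ = B p.1 p.2 := by
        rw [map_add, add_apply, h0, add_zero, h.symm]
      _ ≤ 0 := h2
  have h2 : p.2 = 0 := h.singleValued _ (by rw [← h1]; exact hp)
  rw [← hpy, h1, h2, sub_zero]

end IsMDissipative

/-! ### Yosida approximation and the flow of the linear equation -/

section Primitive

variable {Y : Type*} [NormedAddCommGroup Y]

theorem norm_IccExtend_le {T : ℝ} (hT : 0 ≤ T) (f : C(Icc (0 : ℝ) T, Y)) (s : ℝ) :
    ‖IccExtend hT f s‖ ≤ ‖f‖ :=
  f.norm_coe_le_norm _

theorem continuous_IccExtend {T : ℝ} (hT : 0 ≤ T) (f : C(Icc (0 : ℝ) T, Y)) :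
    Continuous (IccExtend hT f) :=
  f.continuous.Icc_extend'

variable [NormedSpace ℝ Y]

/-- The continuous linear map `f ↦ ∫₀ᵗ f` on `C([0, T]; Y)`. -/
def primitive {T : ℝ} (hT : 0 ≤ T) (t : ℝ) : C(Icc (0 : ℝ) T, Y) →L[ℝ] Y :=
  LinearMap.mkContinuous
    { toFun := fun f => ∫ s in (0 : ℝ)..t, IccExtend hT f s
      map_add' := fun f g => by
        rw [← intervalIntegral.integral_add ((continuous_IccExtend hT f).intervalIntegrable _ _)
          ((continuous_IccExtend hT g).intervalIntegrable _ _)]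
        rfl
      map_smul' := fun r f => by
        rw [RingHom.id_apply, ← intervalIntegral.integral_smul]
        rfl } |t| fun f => by
    have := intervalIntegral.norm_integral_le_of_norm_le_const
      (a := 0) (b := t) (C := ‖f‖) (f := IccExtend hT f) fun s _ => norm_IccExtend_le hT f s
    rw [sub_zero, mul_comm] at this
    exact this

theorem primitive_apply {T : ℝ} (hT : 0 ≤ T) (t : ℝ) (f : C(Icc (0 : ℝ) T, Y)) :
    primitive hT t f = ∫ s in (0 : ℝ)..t, IccExtend hT f s := rfl

end Primitive

namespace IsMDissipative

variable {X : Type*} [NormedAddCommGroup X] [InnerProductSpace ℝ X]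
  {B : X →L[ℝ] X →L[ℝ] ℝ} {G : Submodule ℝ (X × X)}

/-- The flow `E` of the Yosida approximation `A = (J - 1) / ε` of `G`, with its contraction
estimates in the energy norm. -/
theorem exists_yosida_flow [CompleteSpace X] (h : IsMDissipative B G) {ε : ℝ} (hε : 0 < ε) :
    ∃ (A : X →L[ℝ] X) (E : ℝ → X →L[ℝ] X), E 0 = 1 ∧ (∀ t, HasDerivAt E (A * E t) t) ∧
      (∀ z, (z + ε • A z, A z) ∈ G) ∧
      (∀ t, 0 ≤ t → ∀ x, B (E t x) (E t x) ≤ B x x) ∧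
      ∀ p ∈ G, ∀ t, 0 ≤ t → B (A (E t p.1)) (A (E t p.1)) ≤ B p.2 p.2 := by
  obtain ⟨J, hJ1, hJ2⟩ := h.exists_resolvent hε
  set A : X →L[ℝ] X := ε⁻¹ • (J - 1) with hA
  have hAz : ∀ z, A z = ε⁻¹ • (J z - z) := fun z => rfl
  have hJA : ∀ z, z + ε • A z = J z := fun z => by
    rw [hAz, smul_inv_smul₀ hε.ne', add_sub_cancel]
  have hmem : ∀ z, (z + ε • A z, A z) ∈ G := fun z => by
    rw [hJA]
    exact hJ1 z
  have hdiss : ∀ z, B z (A z) ≤ 0 := fun z => by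
    have h1 := h.dissip _ (hmem z)
    have h2 := h.form_nonneg (A z)
    simp only [map_add, map_smul, add_apply, smul_apply, smul_eq_mul] at h1
    nlinarith
  have hE : ∀ t : ℝ, HasDerivAt (fun s : ℝ => NormedSpace.exp (s • A))
      (A * NormedSpace.exp (t • A)) t := fun t => hasDerivAt_exp_smul_const' A t
  have hEx : ∀ (x : X) (t : ℝ), HasDerivAt (fun s : ℝ => NormedSpace.exp (s • A) x)
      (A (NormedSpace.exp (t • A) x)) t := fun x t => by
    have := (hE t).clm_apply (hasDerivAt_const t x)
    simpa using this
  have hcontr : ∀ t : ℝ, 0 ≤ t → ∀ x,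
      B (NormedSpace.exp (t • A) x) (NormedSpace.exp (t • A) x) ≤ B x x := fun t ht x => by
    have := h.form_growth (u := fun s : ℝ => NormedSpace.exp (s • A) x) (T := t) (K := 0)
      (fun s _ => (hEx x s).continuousAt.continuousWithinAt) (fun s _ => hEx x s)
      (fun s _ => hdiss _) (right_mem_Icc.2 ht)
    simpa using this
  refine ⟨A, fun s => NormedSpace.exp (s • A), by simp, hE, hmem, hcontr, fun p hp t ht => ?_⟩
  have hcomm : A (NormedSpace.exp (t • A) p.1) = NormedSpace.exp (t • A) (A p.1) := by
    have : Commute A (NormedSpace.exp (t • A)) :=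
      ((Commute.refl A).smul_right t).exp_right
    exact DFunLike.congr_fun this.eq p.1
  have hAJ : A p.1 = J p.2 := by
    have h1 := hJ2 p hp
    rw [map_sub, map_smul, sub_eq_iff_eq_add] at h1
    rw [hAz, h1, add_sub_cancel_left, inv_smul_smul₀ hε.ne']
  rw [hcomm, hAJ]
  refine (hcontr t ht _).trans ?_
  have h1 := h.form_le_form_sub hε (hJ1 p.2)
  rwa [smul_inv_smul₀ hε.ne', sub_sub_cancel] at h1

/-- Two Yosida flows started at a point of the domain stay close to one another: up to the terms
`ε₁ A₁ z₁` and `ε₂ A₂ z₂`, which are bounded along the flows, the difference of the points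
`(z + ε A z, A z)` of `G` is dissipative. -/
theorem exists_yosida_bound (h : IsMDissipative B G) (p : X × X) :
    ∃ K : ℝ, 0 ≤ K ∧ ∀ (ε₁ ε₂ : ℝ), 0 < ε₁ → 0 < ε₂ →
      ∀ (A₁ A₂ : X →L[ℝ] X) (E₁ E₂ : ℝ → X →L[ℝ] X), E₁ 0 = 1 → E₂ 0 = 1 →
      (∀ t, HasDerivAt E₁ (A₁ * E₁ t) t) → (∀ t, HasDerivAt E₂ (A₂ * E₂ t) t) →
      (∀ z, (z + ε₁ • A₁ z, A₁ z) ∈ G) → (∀ z, (z + ε₂ • A₂ z, A₂ z) ∈ G) →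
      (∀ t, 0 ≤ t → B (A₁ (E₁ t p.1)) (A₁ (E₁ t p.1)) ≤ B p.2 p.2) →
      (∀ t, 0 ≤ t → B (A₂ (E₂ t p.1)) (A₂ (E₂ t p.1)) ≤ B p.2 p.2) →
      ∀ t, 0 ≤ t → ‖E₁ t p.1 - E₂ t p.1‖ ^ 2 ≤ K * (ε₁ + ε₂) * t := by
  obtain ⟨m, hm, hB⟩ := h.coercive
  obtain ⟨M, hM, hb⟩ := h.exists_norm_bound
  set R := M * ‖p.2‖ with hR
  have hR0 : 0 ≤ R := by positivity
  refine ⟨2 * (‖B‖ * R * (2 * R)) / m, by positivity, ?_⟩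
  intro ε₁ ε₂ hε₁ hε₂ A₁ A₂ E₁ E₂ h₁0 h₂0 hd₁ hd₂ hm₁ hm₂ hb₁ hb₂ t ht
  have key := h.form_growth (u := fun s => E₁ s p.1 - E₂ s p.1)
    (u' := fun s => A₁ (E₁ s p.1) - A₂ (E₂ s p.1)) (T := t)
    (K := ‖B‖ * ((ε₁ + ε₂) * R) * (2 * R))
    (by
      have h1 : Continuous E₁ := continuous_iff_continuousAt.2 fun s => (hd₁ s).continuousAt
      have h2 : Continuous E₂ := continuous_iff_continuousAt.2 fun s => (hd₂ s).continuousAt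
      fun_prop)
    (fun s _ => by
      have h1 := (hd₁ s).clm_apply (hasDerivAt_const s p.1)
      have h2 := (hd₂ s).clm_apply (hasDerivAt_const s p.1)
      refine (h1.sub h2).congr_deriv ?_
      simp)
    (fun s hs => by
      set z₁ := E₁ s p.1
      set z₂ := E₂ s p.1
      set a₁ := A₁ z₁
      set a₂ := A₂ z₂
      have n₁ : ‖a₁‖ ≤ R := hb _ _ (hb₁ s hs.1.le)
      have n₂ : ‖a₂‖ ≤ R := hb _ _ (hb₂ s hs.1.le)
      have hd := h.dissip _ (G.sub_mem (hm₁ z₁) (hm₂ z₂))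
      have e : z₁ - z₂ = ((z₁ + ε₁ • a₁) - (z₂ + ε₂ • a₂)) + (ε₂ • a₂ - ε₁ • a₁) := by abel
      have n₃ : ‖ε₂ • a₂ - ε₁ • a₁‖ ≤ (ε₁ + ε₂) * R := by
        refine (norm_sub_le _ _).trans ?_
        rw [norm_smul, norm_smul, Real.norm_of_nonneg hε₁.le, Real.norm_of_nonneg hε₂.le]
        nlinarith
      have n₄ : ‖a₁ - a₂‖ ≤ 2 * R := (norm_sub_le _ _).trans (by linarith)
      calc B (z₁ - z₂) (a₁ - a₂)
          = B ((z₁ + ε₁ • a₁) - (z₂ + ε₂ • a₂)) (a₁ - a₂)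
            + B (ε₂ • a₂ - ε₁ • a₁) (a₁ - a₂) := by
            rw [← add_apply, ← map_add, ← e]
        _ ≤ 0 + ‖B‖ * ‖ε₂ • a₂ - ε₁ • a₁‖ * ‖a₁ - a₂‖ :=
            add_le_add hd (form_le_norm_sq B _ _)
        _ ≤ ‖B‖ * ((ε₁ + ε₂) * R) * (2 * R) := by
            rw [zero_add]
            gcongr)
    (right_mem_Icc.2 ht)
  simp only [h₁0, h₂0, sub_self, map_zero, zero_add] at key
  have h3 : m * ‖E₁ t p.1 - E₂ t p.1‖ ^ 2 ≤ 2 * (‖B‖ * ((ε₁ + ε₂) * R) * (2 * R)) * t := by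
    refine le_trans ?_ key
    rw [pow_two, ← mul_assoc]
    exact hB _
  rw [← le_div_iff₀' hm] at h3
  refine h3.trans (le_of_eq ?_)
  ring

/-- The flow of an `m`-dissipative operator `G`: `t ↦ Γ x t` is continuous and solves
`Γ x t = x + G ∫₀ᵗ Γ x`. -/
theorem exists_flow [CompleteSpace X] (h : IsMDissipative B G) :
    ∃ M : ℝ, 0 < M ∧ ∀ (T : ℝ) (hT : 0 ≤ T), ∃ Γ : X →L[ℝ] C(Icc (0 : ℝ) T, X),
      (∀ x, ‖Γ x‖ ≤ M * ‖x‖) ∧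
      ∀ x (t : Icc (0 : ℝ) T), (primitive hT t (Γ x), Γ x t - x) ∈ G := by
  obtain ⟨M, hM, hb⟩ := h.exists_norm_bound
  refine ⟨M, hM, fun T hT => ?_⟩
  -- `Γ` is the strong limit of the Yosida flows for `ε = 1 / (n + 1)`.
  choose A E hE0 hEd hG hEb hAb using fun n : ℕ =>
    h.exists_yosida_flow (ε := 1 / ((n : ℝ) + 1)) Nat.one_div_pos_of_nat
  have hEc : ∀ n, Continuous (E n) := fun n =>
    continuous_iff_continuousAt.2 fun s => (hEd n s).continuousAt
  let Γ' : ℕ → X →ₗ[ℝ] C(Icc (0 : ℝ) T, X) := fun n =>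
    { toFun := fun x => ⟨fun t => E n t x, by have := hEc n; fun_prop⟩
      map_add' := fun x y => by ext t; simp
      map_smul' := fun r x => by ext t; simp }
  have hΓ' : ∀ n x (t : Icc (0 : ℝ) T), Γ' n x t = E n t x := fun n x t => rfl
  have hbound : ∀ n x, ‖Γ' n x‖ ≤ M * ‖x‖ := fun n x => by
    rw [ContinuousMap.norm_le _ (by positivity)]
    exact fun t => hb _ _ (hEb n t t.2.1 x)
  have hcauchy_dom : ∀ x ∈ {x : X | ∃ y, (x, y) ∈ G}, CauchySeq fun n => Γ' n x := by
    rintro x ⟨y, hxy⟩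
    obtain ⟨K, hK, hKb⟩ := h.exists_yosida_bound (x, y)
    refine cauchySeq_of_le_tendsto_0 (fun N : ℕ => √(K * (2 * (1 / ((N : ℝ) + 1))) * T))
      (fun n k N hn hk => ?_) ?_
    · rw [ContinuousMap.dist_le (by positivity)]
      intro t
      rw [hΓ', hΓ', dist_eq_norm]
      refine Real.le_sqrt_of_sq_le ((hKb _ _ Nat.one_div_pos_of_nat Nat.one_div_pos_of_nat
        (A n) (A k) (E n) (E k) (hE0 n) (hE0 k) (hEd n) (hEd k) (hG n) (hG k) (hAb n _ hxy)
        (hAb k _ hxy) t t.2.1).trans ?_)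
      have h1 : 1 / ((n : ℝ) + 1) ≤ 1 / ((N : ℝ) + 1) := Nat.one_div_le_one_div hn
      have h2 : 1 / ((k : ℝ) + 1) ≤ 1 / ((N : ℝ) + 1) := Nat.one_div_le_one_div hk
      have h3 := t.2.2
      have h4 := t.2.1
      gcongr
      linarith
    · have h1 := tendsto_one_div_add_atTop_nhds_zero_nat (𝕜 := ℝ)
      have h2 := (((h1.const_mul 2).const_mul K).mul_const T).sqrt
      simpa using h2
  -- Convergence extends from the dense domain to all of `X`, the flows being uniformly bounded.
  have hcauchy : ∀ x, CauchySeq fun n => Γ' n x := by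
    intro x
    rw [Metric.cauchySeq_iff]
    intro δ hδ
    obtain ⟨x', hx', hxx'⟩ := Metric.dense_iff.1 h.dense_domain x (δ / (3 * M)) (by positivity)
    obtain ⟨N, hN⟩ := Metric.cauchySeq_iff.1 (hcauchy_dom x' hxx') (δ / 3) (by positivity)
    have hclose : ∀ n, dist (Γ' n x) (Γ' n x') < δ / 3 := fun n => by
      rw [dist_eq_norm, ← map_sub]
      refine (hbound n _).trans_lt ?_
      rw [Metric.mem_ball, dist_comm, dist_eq_norm, lt_div_iff₀ (by positivity)] at hx'
      linarith
    refine ⟨N, fun n hn k hk => ?_⟩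
    have h1 := dist_triangle4_right (Γ' n x) (Γ' k x) (Γ' n x') (Γ' k x')
    linarith [hclose n, hclose k, hN n hn k hk]
  choose Γ₀ hΓ₀ using fun x => cauchySeq_tendsto_of_complete (hcauchy x)
  have hΓ₀b : ∀ x, ‖Γ₀ x‖ ≤ M * ‖x‖ := fun x =>
    le_of_tendsto (hΓ₀ x).norm (Eventually.of_forall fun n => hbound n x)
  let Γ : X →L[ℝ] C(Icc (0 : ℝ) T, X) := LinearMap.mkContinuous
    { toFun := Γ₀
      map_add' := fun x y => tendsto_nhds_unique (hΓ₀ _) (by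
        simpa only [map_add] using (hΓ₀ x).add (hΓ₀ y))
      map_smul' := fun r x => tendsto_nhds_unique (hΓ₀ _) (by
        simpa only [map_smul, RingHom.id_apply] using (hΓ₀ x).const_smul r) } M hΓ₀b
  refine ⟨Γ, hΓ₀b, fun x t => ?_⟩
  change (primitive hT t (Γ₀ x), Γ₀ x t - x) ∈ G
  have heval : Tendsto (fun n => Γ' n x t) atTop (𝓝 (Γ₀ x t)) :=
    ((continuous_eval_const t).tendsto _).comp (hΓ₀ x)
  have hprim : Tendsto (fun n => primitive hT t (Γ' n x)) atTop (𝓝 (primitive hT t (Γ₀ x))) :=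
    ((primitive hT (t : ℝ)).continuous.tendsto _).comp (hΓ₀ x)
  have hstep : ∀ n : ℕ, A n (primitive hT t (Γ' n x)) = Γ' n x t - x := fun n => by
    have hc : Continuous fun s => E n s x := by have := hEc n; fun_prop
    have h1 : primitive hT t (Γ' n x) = ∫ s in (0 : ℝ)..t, E n s x := by
      rw [primitive_apply]
      refine intervalIntegral.integral_congr fun s hs => ?_
      rw [uIcc_of_le t.2.1] at hs
      simp only [IccExtend_of_mem hT _ ⟨hs.1, hs.2.trans t.2.2⟩]
      rfl
    have h2 := intervalIntegral.integral_eq_sub_of_hasDerivAt (a := 0) (b := (t : ℝ))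
      (f := fun s => E n s x) (f' := fun s => A n (E n s x))
      (fun s _ => by simpa using (hEd n s).clm_apply (hasDerivAt_const s x))
      (((A n).continuous.comp hc).intervalIntegrable _ _)
    rw [h1, ← ContinuousLinearMap.intervalIntegral_comp_comm _ (hc.intervalIntegrable _ _), h2,
      hE0]
    rfl
  -- The integrated equation passes to the limit as `G` is closed.
  have hlim : Tendsto (fun n : ℕ => (primitive hT t (Γ' n x) +
      (1 / ((n : ℝ) + 1)) • (Γ' n x t - x), Γ' n x t - x)) atTop
      (𝓝 (primitive hT t (Γ₀ x) + (0 : ℝ) • (Γ₀ x t - x), Γ₀ x t - x)) :=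
    (hprim.add (tendsto_one_div_add_atTop_nhds_zero_nat.smul (heval.sub_const x))).prodMk_nhds
      (heval.sub_const x)
  rw [zero_smul, add_zero] at hlim
  refine h.isClosed.mem_of_tendsto hlim (Eventually.of_forall fun n => ?_)
  have := hG n (primitive hT t (Γ' n x))
  rwa [hstep n] at this

end IsMDissipative

/-! ### The inhomogeneous linear equation -/

section Integrals

variable {Y : Type*} [NormedAddCommGroup Y] [NormedSpace ℝ Y]

/-- Fubini's theorem on a triangle. -/
theorem integral_integral_triangle {F : ℝ → ℝ → Y} (hF : Continuous (Function.uncurry F))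
    {t : ℝ} (ht : 0 ≤ t) :
    ∫ r in (0 : ℝ)..t, ∫ s in (0 : ℝ)..r, F r s = ∫ s in (0 : ℝ)..t, ∫ r in s..t, F r s := by
  have hl : ∀ r ∈ uIcc 0 t, ∫ s in (0 : ℝ)..r, F r s =
      ∫ s in Ioc 0 t, (Iic r).indicator (F r) s := fun r hr => by
    rw [uIcc_of_le ht] at hr
    rw [intervalIntegral.integral_of_le hr.1, setIntegral_indicator measurableSet_Iic,
      Ioc_inter_Iic, min_eq_right hr.2]
  have hr : ∀ s ∈ uIoc 0 t, ∫ r in s..t, F r s =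
      ∫ r in Ioc 0 t, (Iic r).indicator (F r) s := fun s hs => by
    rw [uIoc_of_le ht] at hs
    have : ∀ r, (Iic r).indicator (F r) s = (Ici s).indicator (fun r => F r s) r := fun r => by
      simp only [indicator, mem_Iic, mem_Ici]
    simp only [this]
    rw [intervalIntegral.integral_of_le hs.2, setIntegral_indicator measurableSet_Ici,
      ← integral_Icc_eq_integral_Ioc]
    congr 2
    ext r
    simp only [mem_Icc, mem_inter_iff, mem_Ioc, mem_Ici]
    exact ⟨fun h => ⟨⟨hs.1.trans_le h.1, h.2⟩, h.1⟩, fun h => ⟨h.2, h.1.2⟩⟩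
  rw [intervalIntegral.integral_congr hl,
    intervalIntegral.integral_congr_ae (Eventually.of_forall hr),
    intervalIntegral.integral_of_le ht, intervalIntegral.integral_of_le ht]
  refine integral_integral_swap ?_
  rw [Measure.prod_restrict]
  have h1 : Function.uncurry (fun r s => (Iic r).indicator (F r) s) =
      {p : ℝ × ℝ | p.2 ≤ p.1}.indicator (Function.uncurry F) := by
    ext ⟨r, s⟩
    simp only [Function.uncurry, indicator, mem_Iic, mem_ofPred_eq]
  rw [h1]
  refine IntegrableOn.indicator ?_ (measurableSet_le measurable_snd measurable_fst)
  exact (hF.continuousOn.integrableOn_compact (isCompact_Icc.prod isCompact_Icc)).mono_set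
    (prod_mono Ioc_subset_Icc_self Ioc_subset_Icc_self)

/-- A closed subspace contains the integrals of continuous functions with values in it. -/
theorem intervalIntegral_mem [CompleteSpace Y] (S : Submodule ℝ Y) (hS : IsClosed (S : Set Y))
    {φ : ℝ → Y} (hφ : Continuous φ) {t : ℝ} (ht : 0 ≤ t) (hmem : ∀ s ∈ Icc 0 t, φ s ∈ S) :
    ∫ s in (0 : ℝ)..t, φ s ∈ S := by
  have : CompleteSpace S := hS.completeSpace_coe
  let ψ : ℝ → S := fun s => ⟨φ (projIcc 0 t ht s), hmem _ (projIcc 0 t ht s).2⟩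
  have hψ : Continuous ψ :=
    (hφ.comp (continuous_subtype_val.comp continuous_projIcc)).subtype_mk _
  have h1 : ∫ s in (0 : ℝ)..t, φ s = ∫ s in (0 : ℝ)..t, S.subtypeL (ψ s) := by
    refine intervalIntegral.integral_congr fun s hs => ?_
    rw [uIcc_of_le ht] at hs
    simp only [ψ, projIcc_of_mem ht hs]
    rfl
  rw [h1, ContinuousLinearMap.intervalIntegral_comp_comm _ (hψ.intervalIntegrable _ _)]
  exact (∫ s in (0 : ℝ)..t, ψ s).2

end Integrals

namespace IsMDissipative

variable {X : Type*} [NormedAddCommGroup X] [InnerProductSpace ℝ X]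
  {B : X →L[ℝ] X →L[ℝ] ℝ} {G : Submodule ℝ (X × X)}

/-- Duhamel's formula: `Γ x + K f` solves `w(t) = x + G ∫₀ᵗ w + ∫₀ᵗ f`. -/
theorem exists_duhamel [CompleteSpace X] (h : IsMDissipative B G) :
    ∃ M : ℝ, 0 < M ∧ ∀ (T : ℝ) (hT : 0 ≤ T), ∃ (Γ : X →L[ℝ] C(Icc (0 : ℝ) T, X))
      (K : C(Icc (0 : ℝ) T, X) →L[ℝ] C(Icc (0 : ℝ) T, X)),
      (∀ f, ‖K f‖ ≤ M * T * ‖f‖) ∧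
      ∀ x f (t : Icc (0 : ℝ) T),
        (primitive hT t (Γ x + K f), (Γ x + K f) t - x - primitive hT t f) ∈ G := by
  obtain ⟨M, hM, hflow⟩ := h.exists_flow
  refine ⟨M, hM, fun T hT => ?_⟩
  obtain ⟨Γ, hΓ, hG⟩ := hflow T hT
  -- The flow as a function of two variables; `K f` is its convolution with `f`.
  let g : ℝ → X → X := fun τ x => Γ x (projIcc 0 T hT τ)
  have hg : Continuous (Function.uncurry g) :=
    (Γ.continuous.comp continuous_snd).eval (continuous_projIcc.comp continuous_fst)
  have hgadd : ∀ τ x y, g τ (x + y) = g τ x + g τ y := fun τ x y => by simp [g]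
  have hgsmul : ∀ τ (r : ℝ) x, g τ (r • x) = r • g τ x := fun τ r x => by simp [g]
  have hgb : ∀ τ x, ‖g τ x‖ ≤ M * ‖x‖ := fun τ x =>
    ((Γ x).norm_coe_le_norm _).trans (hΓ x)
  have hint : ∀ (f : C(Icc (0 : ℝ) T, X)) (r : ℝ),
      Continuous fun τ => g τ (IccExtend hT f (r - τ)) := fun f r => by
    have := continuous_IccExtend hT f
    exact hg.comp (continuous_id.prodMk (this.comp (by fun_prop)))
  have hcont : ∀ f : C(Icc (0 : ℝ) T, X),
      Continuous fun r : ℝ => ∫ τ in (0 : ℝ)..r, g τ (IccExtend hT f (r - τ)) := fun f => by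
    have := continuous_IccExtend hT f
    exact intervalIntegral.continuous_parametric_intervalIntegral_of_continuous
      (f := fun r τ => g τ (IccExtend hT f (r - τ)))
      (hg.comp (continuous_snd.prodMk (this.comp (continuous_fst.sub continuous_snd))))
      continuous_id
  let K₀ : C(Icc (0 : ℝ) T, X) →ₗ[ℝ] C(Icc (0 : ℝ) T, X) :=
    { toFun := fun f => ⟨fun r => ∫ τ in (0 : ℝ)..r, g τ (IccExtend hT f (r - τ)),
        (hcont f).comp continuous_subtype_val⟩
      map_add' := fun f₁ f₂ => by
        ext r
        simp only [ContinuousMap.coe_mk, ContinuousMap.add_apply]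
        rw [← intervalIntegral.integral_add ((hint f₁ r).intervalIntegrable _ _)
          ((hint f₂ r).intervalIntegrable _ _)]
        simp only [← hgadd]
        rfl
      map_smul' := fun a f => by
        ext r
        simp only [ContinuousMap.coe_mk, ContinuousMap.smul_apply, RingHom.id_apply]
        rw [← intervalIntegral.integral_smul]
        simp only [← hgsmul]
        rfl }
  have hK₀ : ∀ f, ‖K₀ f‖ ≤ M * T * ‖f‖ := fun f => by
    rw [ContinuousMap.norm_le _ (by positivity)]
    intro r
    have h1 := intervalIntegral.norm_integral_le_of_norm_le_const
      (a := 0) (b := (r : ℝ)) (C := M * ‖f‖) (f := fun τ => g τ (IccExtend hT f (r - τ)))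
      fun τ _ => (hgb _ _).trans
        (mul_le_mul_of_nonneg_left (norm_IccExtend_le hT f _) hM.le)
    rw [sub_zero, abs_of_nonneg r.2.1] at h1
    refine h1.trans ?_
    rw [mul_right_comm]
    exact mul_le_mul_of_nonneg_right (mul_le_mul_of_nonneg_left r.2.2 hM.le) (norm_nonneg f)
  refine ⟨Γ, K₀.mkContinuous _ hK₀, hK₀, fun x f t => ?_⟩
  set K := K₀.mkContinuous _ hK₀
  have ht : (0 : ℝ) ≤ t := t.2.1
  set fe := IccExtend hT f with hfe
  have hfec : Continuous fe := continuous_IccExtend hT f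
  have hKt : ∀ r ∈ Icc (0 : ℝ) T, IccExtend hT (K f) r = ∫ s in (0 : ℝ)..r, g (r - s) (fe s) :=
    fun r hr => by
    rw [IccExtend_of_mem hT _ hr]
    change ∫ τ in (0 : ℝ)..r, g τ (fe (r - τ)) = _
    have := intervalIntegral.integral_comp_sub_left (a := 0) (b := r)
      (fun s => g (r - s) (fe s)) r
    simp only [sub_sub_cancel, sub_self, sub_zero] at this
    exact this
  have hprim : primitive hT t (K f) =
      ∫ s in (0 : ℝ)..t, primitive hT (t - s) (Γ (fe s)) := by
    have h1 : primitive hT t (K f) =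
        ∫ r in (0 : ℝ)..t, ∫ s in (0 : ℝ)..r, g (r - s) (fe s) := by
      rw [primitive_apply]
      refine intervalIntegral.integral_congr fun r hr => ?_
      rw [uIcc_of_le ht] at hr
      exact hKt r ⟨hr.1, hr.2.trans t.2.2⟩
    rw [h1, integral_integral_triangle (F := fun r s => g (r - s) (fe s)) _ ht]
    · refine intervalIntegral.integral_congr fun s _ => ?_
      have := intervalIntegral.integral_comp_sub_right (a := s) (b := (t : ℝ))
        (fun τ => g τ (fe s)) s
      simp only [sub_self] at this
      exact this
    · exact hg.comp ((continuous_fst.sub continuous_snd).prodMk (hfec.comp continuous_snd))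
  have hpc : Continuous fun s : ℝ => primitive hT (t - s) (Γ (fe s)) :=
    intervalIntegral.continuous_parametric_intervalIntegral_of_continuous
      (f := fun s τ => g τ (fe s)) (s := fun s => (t : ℝ) - s)
      (hg.comp (continuous_snd.prodMk (hfec.comp continuous_fst)))
      (by fun_prop)
  have hqc : Continuous fun s : ℝ => g (t - s) (fe s) :=
    hg.comp ((by fun_prop : Continuous fun s : ℝ => (t : ℝ) - s).prodMk hfec)
  -- Integrate the membership in `G` of the pair that belongs to the flow started at `f s`.
  have hmem := intervalIntegral_mem G h.isClosed
    (φ := fun s => (primitive hT (t - s) (Γ (fe s)), g (t - s) (fe s) - fe s))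
    (hpc.prodMk (hqc.sub hfec)) ht fun s hs => by
      have hts : (t : ℝ) - s ∈ Icc (0 : ℝ) T :=
        ⟨sub_nonneg.2 hs.2, (sub_le_self _ hs.1).trans t.2.2⟩
      have := hG (fe s) ⟨_, hts⟩
      change (primitive hT (t - s) (Γ (fe s)), Γ (fe s) (projIcc 0 T hT (t - s)) - fe s) ∈ G
      rwa [projIcc_of_mem hT hts]
  have hpair : ∫ s in (0 : ℝ)..t, (primitive hT (t - s) (Γ (fe s)), g (t - s) (fe s) - fe s) =
      (primitive hT t (K f), K f t - primitive hT t f) := by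
    have hi : IntervalIntegrable
        (fun s => (primitive hT (t - s) (Γ (fe s)), g (t - s) (fe s) - fe s)) volume 0 t :=
      (hpc.prodMk (hqc.sub hfec)).intervalIntegrable _ _
    refine Prod.ext ?_ ?_
    · have := (ContinuousLinearMap.fst ℝ X X).intervalIntegral_comp_comm hi
      rw [hprim]
      exact this.symm
    · have := (ContinuousLinearMap.snd ℝ X X).intervalIntegral_comp_comm hi
      refine this.symm.trans ?_
      simp only [ContinuousLinearMap.coe_snd']
      rw [intervalIntegral.integral_sub (hqc.intervalIntegrable _ _)
        (hfec.intervalIntegrable _ _), ← hKt t t.2, IccExtend_val]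
      rfl
  rw [hpair] at hmem
  have := G.add_mem (hG x t) hmem
  rw [Prod.mk_add_mk, ← map_add] at this
  convert this using 2
  rw [ContinuousMap.add_apply]
  abel

/-- Uniqueness for the linear problem: the energy of the primitive of a solution with zero data
cannot grow. -/
theorem eq_zero_of_primitive_mem [CompleteSpace X] (h : IsMDissipative B G) {T : ℝ} (hT : 0 ≤ T)
    (d : C(Icc (0 : ℝ) T, X)) (hd : ∀ t : Icc (0 : ℝ) T, (primitive hT t d, d t) ∈ G) :
    d = 0 := by
  have hc := continuous_IccExtend hT d
  have hder : ∀ t : ℝ, HasDerivAt (fun t => primitive hT t d) (IccExtend hT d t) t := fun t =>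
    intervalIntegral.integral_hasDerivAt_right (hc.intervalIntegrable _ _)
      (hc.stronglyMeasurableAtFilter _ _) hc.continuousAt
  have hzero : ∀ t : Icc (0 : ℝ) T, primitive hT t d = 0 := fun t => by
    refine h.form_eq_zero ?_
    have := h.form_growth (u := fun t => primitive hT t d) (u' := IccExtend hT d) (T := T) (K := 0)
      (fun s _ => (hder s).continuousAt.continuousWithinAt) (fun s _ => hder s)
      (fun s hs => by
        have := h.dissip _ (hd ⟨s, hs.1.le, hs.2.le⟩)
        rwa [IccExtend_of_mem hT _ ⟨hs.1.le, hs.2.le⟩]) t.2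
    have h0 : primitive hT 0 d = 0 := by simp [primitive_apply]
    simpa [h0] using this
  ext t
  refine h.singleValued _ ?_
  rw [← hzero t]
  exact hd t

end IsMDissipative

/-! ### Superposition operators and the semilinear equation -/

section Superposition

universe u

variable {K : Type*} [TopologicalSpace K] [CompactSpace K]
  {X Y : Type u} [NormedAddCommGroup X] [NormedSpace ℝ X] [NormedAddCommGroup Y] [NormedSpace ℝ Y]

/-- Pointwise application `(A, f) ↦ (t ↦ A(t) f(t))` of a continuous family of operators. -/
def pointwiseApply (K X Y : Type*) [TopologicalSpace K] [CompactSpace K]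
    [NormedAddCommGroup X] [NormedSpace ℝ X] [NormedAddCommGroup Y] [NormedSpace ℝ Y] :
    C(K, X →L[ℝ] Y) →L[ℝ] C(K, X) →L[ℝ] C(K, Y) :=
  LinearMap.mkContinuous₂
    (LinearMap.mk₂ ℝ (fun (A : C(K, X →L[ℝ] Y)) (f : C(K, X)) =>
        (⟨fun t => A t (f t), by fun_prop⟩ : C(K, Y)))
      (fun A₁ A₂ f => by ext t; simp) (fun r A f => by ext t; simp)
      (fun A f₁ f₂ => by ext t; simp) (fun r A f => by ext t; simp)) 1 fun A f => by
    rw [one_mul, ContinuousMap.norm_le _ (by positivity)]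
    exact fun t => ((A t).le_opNorm _).trans
      (mul_le_mul (A.norm_coe_le_norm t) (f.norm_coe_le_norm t) (norm_nonneg (f t)) (norm_nonneg A))

/-- The superposition operator `f ↦ N ∘ f` on continuous functions is differentiable if `N` is
continuously differentiable. -/
theorem hasFDerivAt_comp {N : X → Y} (hN : Continuous N) {N' : X → X →L[ℝ] Y}
    (hN' : Continuous N') (hd : ∀ x, HasFDerivAt N (N' x) x) (f : C(K, X)) :
    HasFDerivAt (fun f : C(K, X) => (⟨N, hN⟩ : C(X, Y)).comp f)
      (pointwiseApply K X Y ((⟨N', hN'⟩ : C(X, X →L[ℝ] Y)).comp f)) f := by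
  rw [hasFDerivAt_iff_isLittleO_nhds_zero, Asymptotics.isLittleO_iff]
  intro ε hε
  have hcont : Continuous fun f : C(K, X) => (⟨N', hN'⟩ : C(X, X →L[ℝ] Y)).comp f :=
    ContinuousMap.continuous_postcomp _
  have hcont_f : ContinuousAt (fun f : C(K, X) => (⟨N', hN'⟩ : C(X, X →L[ℝ] Y)).comp f) f :=
    hcont.continuousAt
  obtain ⟨δ, hδ, hball⟩ : ∃ δ > 0, ∀ ⦃g : C(K, X)⦄, dist g f < δ →
      dist ((⟨N', hN'⟩ : C(X, X →L[ℝ] Y)).comp g) ((⟨N', hN'⟩ : C(X, X →L[ℝ] Y)).comp f) < ε :=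
    (Metric.continuousAt_iff (α := C(K, X)) (β := C(K, X →L[ℝ] Y))).1 hcont_f ε hε
  filter_upwards [Metric.ball_mem_nhds (0 : C(K, X)) hδ] with k hk
  rw [mem_ball_zero_iff] at hk
  rw [ContinuousMap.norm_le _ (by positivity)]
  intro t
  have hseg : ∀ y ∈ segment ℝ (f t) (f t + k t), ‖N' y - N' (f t)‖ ≤ ε := by
    rintro y hy
    rw [segment_eq_image'] at hy
    obtain ⟨s, hs, rfl⟩ := hy
    have h1 : dist (f + s • k) f < δ := by
      rw [dist_eq_norm, add_sub_cancel_left, norm_smul, Real.norm_of_nonneg hs.1]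
      exact (mul_le_of_le_one_left (norm_nonneg k) hs.2).trans_lt hk
    have h2 := (ContinuousMap.dist_apply_le_dist t).trans (hball h1).le
    rw [dist_eq_norm] at h2
    simpa using h2
  have := (convex_segment (f t) (f t + k t)).norm_image_sub_le_of_norm_hasFDerivWithin_le'
    (fun y _ => (hd y).hasFDerivWithinAt) hseg (left_mem_segment ℝ _ _) (right_mem_segment ℝ _ _)
  rw [add_sub_cancel_left] at this
  exact this.trans (mul_le_mul_of_nonneg_left (k.norm_coe_le_norm t) hε.le)

/-- The superposition operator `f ↦ N ∘ f` on continuous functions is as smooth as `N`. -/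
theorem contDiff_comp (n : ℕ) {Y : Type u} [NormedAddCommGroup Y] [NormedSpace ℝ Y] {N : X → Y}
    (hN : ContDiff ℝ n N) :
    ContDiff ℝ n fun f : C(K, X) => (⟨N, hN.continuous⟩ : C(X, Y)).comp f := by
  induction n generalizing Y with
  | zero =>
    exact contDiff_zero.2 (ContinuousMap.continuous_postcomp _)
  | succ n ih =>
    have hN1 : ContDiff ℝ ((n : ℕ∞ω) + 1) N := by exact_mod_cast hN
    obtain ⟨N', hN', hd⟩ := contDiff_succ_iff_hasFDerivAt.1 hN1
    push_cast
    refine contDiff_succ_iff_hasFDerivAt.2 ⟨_, ?_, fun f =>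
      hasFDerivAt_comp hN.continuous hN'.continuous hd f⟩
    exact (pointwiseApply K X Y).contDiff.comp (ih hN')

end Superposition

/-- A contractive `Cⁿ` perturbation of the identity has a `Cⁿ` inverse, defined globally. -/
theorem exists_inverse_id_sub {Z : Type*} [NormedAddCommGroup Z] [NormedSpace ℝ Z]
    [CompleteSpace Z] {Q : Z → Z} {c : ℝ≥0} (hc : c < 1) (hL : LipschitzWith c Q) {n : ℕ∞ω}
    (hn : n ≠ 0) (hQ : ContDiff ℝ n Q) :
    ∃ R : Z → Z, ContDiff ℝ n R ∧ ∀ w z, w - Q w = z ↔ w = R z := by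
  have happrox : ApproximatesLinearOn (fun w => w - Q w)
      ((ContinuousLinearEquiv.refl ℝ Z : Z ≃L[ℝ] Z) : Z →L[ℝ] Z) univ c := by
    intro x _ y _
    have h1 : x - Q x - (y - Q y) - ((ContinuousLinearEquiv.refl ℝ Z : Z ≃L[ℝ] Z) : Z →L[ℝ] Z)
        (x - y) = -(Q x - Q y) := by
      simp only [ContinuousLinearEquiv.coe_refl, ContinuousLinearMap.id_apply]
      abel
    rw [h1, norm_neg]
    exact hL.norm_sub_le x y
  have hcN : Subsingleton Z ∨
      c < ‖((ContinuousLinearEquiv.refl ℝ Z).symm : Z →L[ℝ] Z)‖₊⁻¹ := by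
    rcases subsingleton_or_nontrivial Z with hs | hs
    · exact Or.inl hs
    · right
      have : ‖((ContinuousLinearEquiv.refl ℝ Z).symm : Z →L[ℝ] Z)‖₊ = 1 :=
        NNReal.eq ContinuousLinearMap.norm_id
      rwa [this, inv_one]
  let e : Z ≃ₜ Z := happrox.toHomeomorph _ hcN
  have he : ∀ w, e w = w - Q w := fun w => rfl
  have hnorm : ∀ w, ‖fderiv ℝ Q w‖ < 1 := fun w =>
    (norm_fderiv_le_of_lipschitz ℝ hL).trans_lt (by exact_mod_cast hc)
  let D : Z → Z ≃L[ℝ] Z := fun w =>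
    ContinuousLinearEquiv.unitsEquiv ℝ Z (Units.oneSub (fderiv ℝ Q w) (hnorm w))
  have hder : ∀ w, HasFDerivAt e (D w : Z →L[ℝ] Z) w := fun w => by
    have h1 : HasFDerivAt Q (fderiv ℝ Q w) w :=
      (hQ.differentiable hn w).hasFDerivAt
    exact (hasFDerivAt_id w).sub h1
  refine ⟨e.symm, e.contDiff_symm hder (contDiff_id.sub hQ), fun w z => ?_⟩
  rw [← he, e.eq_symm_apply]

namespace IsMDissipative

/-- The semilinear problem `w' = G w + N(w)` has, on short time intervals, a unique mild solution
for all data, which depends on the data as smoothly as `N` permits. -/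
theorem exists_semilinear_flow {X : Type} [NormedAddCommGroup X] [InnerProductSpace ℝ X]
    [CompleteSpace X] {B : X →L[ℝ] X →L[ℝ] ℝ} {G : Submodule ℝ (X × X)}
    (h : IsMDissipative B G) {N : X → X} {L : ℝ≥0} (hL : LipschitzWith L N) {n : ℕ} (hn : n ≠ 0)
    (hN : ContDiff ℝ n N) :
    ∃ T : ℝ, 0 < T ∧ ∀ (T₀ : ℝ) (hT₀ : 0 < T₀), T₀ ≤ T →
      ∃ S : X → C(Icc (0 : ℝ) T₀, X), ContDiff ℝ n S ∧ ∀ x w,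
        (∀ t : Icc (0 : ℝ) T₀, (primitive hT₀.le t w,
          w t - x - primitive hT₀.le t ((⟨N, hN.continuous⟩ : C(X, X)).comp w)) ∈ G) ↔
        w = S x := by
  obtain ⟨M, hM, hD⟩ := h.exists_duhamel
  -- For this length of the time interval `w ↦ K (N ∘ w)` has the Lipschitz constant `1 / 2`, and
  -- `w - K (N ∘ w) = Γ x` can be solved for `w`.
  refine ⟨1 / (2 * M * (L + 1)), by positivity, fun T₀ hT₀ hle => ?_⟩
  obtain ⟨Γ, K, hK, hG⟩ := hD T₀ hT₀.le
  let F : C(Icc (0 : ℝ) T₀, X) → C(Icc (0 : ℝ) T₀, X) :=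
    fun w => (⟨N, hN.continuous⟩ : C(X, X)).comp w
  have hF : ContDiff ℝ n F := contDiff_comp n hN
  have hFL : ∀ w₁ w₂, ‖F w₁ - F w₂‖ ≤ L * ‖w₁ - w₂‖ := fun w₁ w₂ => by
    rw [ContinuousMap.norm_le _ (by positivity)]
    exact fun t => (hL.norm_sub_le _ _).trans
      (mul_le_mul_of_nonneg_left ((w₁ - w₂).norm_coe_le_norm t) L.2)
  have hQL : LipschitzWith (1 / 2) fun w => K (F w) := by
    refine LipschitzWith.of_dist_le_mul fun w₁ w₂ => ?_
    rw [dist_eq_norm, dist_eq_norm, ← map_sub]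
    have h1 : M * T₀ * L ≤ 1 / 2 := by
      rw [le_div_iff₀ (by positivity)] at hle
      nlinarith [mul_pos hT₀ hM]
    calc ‖K (F w₁ - F w₂)‖ ≤ M * T₀ * ‖F w₁ - F w₂‖ := hK _
      _ ≤ M * T₀ * (L * ‖w₁ - w₂‖) := by gcongr; exact hFL _ _
      _ = M * T₀ * L * ‖w₁ - w₂‖ := by ring
      _ ≤ 1 / 2 * ‖w₁ - w₂‖ := by gcongr
      _ = ((1 / 2 : ℝ≥0) : ℝ) * ‖w₁ - w₂‖ := by norm_num
  obtain ⟨R, hR, hRw⟩ := exists_inverse_id_sub (by norm_num) hQL (n := n)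
    (by exact_mod_cast hn) (K.contDiff.comp hF)
  refine ⟨fun x => R (Γ x), hR.comp Γ.contDiff, fun x w => ?_⟩
  rw [← hRw, sub_eq_iff_eq_add]
  refine ⟨fun hw => ?_, fun hw t => ?_⟩
  · refine sub_eq_zero.1 (h.eq_zero_of_primitive_mem hT₀.le _ fun t => ?_)
    have := G.sub_mem (hw t) (hG x (F w) t)
    rw [Prod.mk_sub_mk, ← map_sub] at this
    convert this using 2
    rw [ContinuousMap.sub_apply]
    change _ = w t - x - primitive hT₀.le t (F w) - _
    abel
  · have := hG x (F w) t
    rw [← hw] at this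
    exact this

end IsMDissipative

/-! ### Weak derivatives on the half-line -/

/-- Integration by parts for primitives of locally integrable functions. -/
theorem integral_by_parts {g k : ℝ → ℝ} (hg : LocallyIntegrable g) (hk : LocallyIntegrable k)
    (a b x y : ℝ) :
    ∫ s in x..y, (g s * (b + ∫ r in (0 : ℝ)..s, k r) + (a + ∫ r in (0 : ℝ)..s, g r) * k s) =
      (a + ∫ r in (0 : ℝ)..y, g r) * (b + ∫ r in (0 : ℝ)..y, k r) -
        (a + ∫ r in (0 : ℝ)..x, g r) * (b + ∫ r in (0 : ℝ)..x, k r) := by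
  have hac : ∀ {g : ℝ → ℝ}, LocallyIntegrable g → ∀ a : ℝ,
      AbsolutelyContinuousOnInterval (fun s => a + ∫ r in (0 : ℝ)..s, g r) x y := by
    intro g hg a
    have hi : ∀ p q, IntervalIntegrable g volume p q := fun p q =>
      (hg.integrableOn_isCompact isCompact_uIcc).intervalIntegrable
    have h1 := ((LipschitzWith.const (a + ∫ r in (0 : ℝ)..x, g r)).lipschitzOnWith
      (s := uIcc x y)).absolutelyContinuousOnInterval
    have h2 := (hi x y).absolutelyContinuousOnInterval_intervalIntegral (c := x) left_mem_uIcc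
    have h3 : (fun s => a + ∫ r in (0 : ℝ)..s, g r) =
        (fun _ => a + ∫ r in (0 : ℝ)..x, g r) + fun s => ∫ r in x..s, g r := by
      ext s
      rw [Pi.add_apply, add_assoc,
        intervalIntegral.integral_add_adjacent_intervals (hi _ _) (hi _ _)]
    rw [h3]
    exact h1.add h2
  rw [← (hac hg a).integral_deriv_mul_eq_sub (hac hk b)]
  refine intervalIntegral.integral_congr_ae ?_
  filter_upwards [_root_.LocallyIntegrable.ae_hasDerivAt_integral hg,
    _root_.LocallyIntegrable.ae_hasDerivAt_integral hk] with s h1 h2 _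
  rw [((h1 0).const_add a).deriv, ((h2 0).const_add b).deriv]

theorem contDiff_infty_eq_primitive {φ : ℝ → ℝ} (hφ : ContDiff ℝ ∞ φ) (x : ℝ) :
    φ x = φ 0 + ∫ r in (0 : ℝ)..x, deriv φ r := by
  rw [intervalIntegral.integral_deriv_eq_sub
    (fun s _ => (hφ.differentiable (by simp)).differentiableAt)
    ((hφ.continuous_deriv (by simp)).intervalIntegrable _ _)]
  ring

theorem exists_subset_Icc_of_isCompact {K : Set ℝ} (hK : IsCompact K) (h0 : K ⊆ Ioi 0) :
    ∃ a b : ℝ, 0 < a ∧ K ⊆ Icc a b := by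
  rcases K.eq_empty_or_nonempty with rfl | hne
  · exact ⟨1, 1, one_pos, empty_subset _⟩
  · obtain ⟨a, ha, ha'⟩ := hK.exists_isLeast hne
    obtain ⟨b, hb, hb'⟩ := hK.exists_isGreatest hne
    exact ⟨a, b, h0 ha, fun x hx => ⟨ha' hx, hb' hx⟩⟩

theorem IsTest.eq_zero {φ : ℝ → ℝ} (h : IsTest φ) {x : ℝ} (hx : x ∉ Ioi (0 : ℝ)) : φ x = 0 :=
  image_eq_zero_of_notMem_tsupport fun h' => hx (h.2.2 h')

theorem IsTest.deriv {φ : ℝ → ℝ} (h : IsTest φ) : IsTest (deriv φ) :=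
  ⟨(contDiff_infty_iff_deriv.1 h.1).2, h.2.1.deriv, tsupport_deriv_subset.trans h.2.2⟩

/-- The fundamental lemma of the calculus of variations on the half-line. -/
theorem ae_eq_zero_of_integral_test_eq_zero {f : ℝ → ℝ}
    (hf : LocallyIntegrableOn f (Ioi (0 : ℝ)))
    (h : ∀ φ, IsTest φ → ∫ x in Ioi (0 : ℝ), f x * φ x = 0) :
    ∀ᵐ x ∂(volume.restrict (Ioi (0 : ℝ))), f x = 0 := by
  refine (ae_restrict_iff' measurableSet_Ioi).2
    (isOpen_Ioi.ae_eq_zero_of_integral_contDiff_smul_eq_zero hf fun φ h1 h2 h3 => ?_)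
  rw [← setIntegral_eq_integral_of_forall_compl_eq_zero (s := Ioi (0 : ℝ))]
  · refine Eq.trans ?_ (h φ ⟨h1, h2, h3⟩)
    exact setIntegral_congr_fun measurableSet_Ioi fun x _ => by
      simp only [smul_eq_mul, mul_comm]
  · intro x hx
    rw [IsTest.eq_zero ⟨h1, h2, h3⟩ hx, zero_smul]

/-- A test function of integral zero is the derivative of a test function. -/
theorem exists_test_deriv_eq {η : ℝ → ℝ} (hη : IsTest η) (h0 : ∫ x in Ioi (0 : ℝ), η x = 0) :
    ∃ φ, IsTest φ ∧ deriv φ = η := by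
  obtain ⟨a, b, ha, hab⟩ := exists_subset_Icc_of_isCompact hη.2.1.isCompact hη.2.2
  have hc := hη.1.continuous
  let φ : ℝ → ℝ := fun x => ∫ r in (0 : ℝ)..x, η r
  have hd : ∀ x, HasDerivAt φ (η x) x := fun x =>
    intervalIntegral.integral_hasDerivAt_right (hc.intervalIntegrable _ _)
      (hc.stronglyMeasurableAtFilter _ _) hc.continuousAt
  have hderiv : deriv φ = η := funext fun x => (hd x).deriv
  have hout : ∀ x, x ∉ Icc a b → η x = 0 := fun x hx =>
    image_eq_zero_of_notMem_tsupport fun h' => hx (hab h')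
  have hsupp : Function.support φ ⊆ Icc a b := by
    intro x hx
    by_contra hx'
    refine hx ?_
    rw [mem_Icc, not_and_or, not_le, not_le] at hx'
    rcases hx' with hxa | hxb
    · refine intervalIntegral.integral_zero_ae
        (Eventually.of_forall fun r hr => hout r fun h' => ?_)
      rw [mem_uIoc] at hr
      rcases hr with hr | hr <;> linarith [h'.1, hr.1, hr.2]
    · by_cases hx0 : 0 ≤ x
      · change ∫ r in (0 : ℝ)..x, η r = 0
        rw [intervalIntegral.integral_of_le hx0]
        refine Eq.trans (Eq.symm ?_) h0
        exact setIntegral_eq_of_subset_of_forall_sdiff_eq_zero measurableSet_Ioi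
          (fun r hr => hr.1) fun r hr => hout r fun h' => hr.2 ⟨hr.1, h'.2.trans hxb.le⟩
      · refine intervalIntegral.integral_zero_ae
          (Eventually.of_forall fun r hr => hout r fun h' => ?_)
        rw [mem_uIoc] at hr
        rcases hr with hr | hr <;> linarith [h'.1, h'.2, hr.1, hr.2]
  refine ⟨φ, ⟨contDiff_infty_iff_deriv.2 ⟨fun x => (hd x).differentiableAt, ?_⟩, ?_, ?_⟩, hderiv⟩
  · rw [hderiv]
    exact hη.1
  · exact HasCompactSupport.of_support_subset_isCompact isCompact_Icc hsupp
  · exact (closure_minimal hsupp isClosed_Icc).trans fun x hx => ha.trans_le hx.1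

theorem exists_test_integral_eq_one : ∃ ψ, IsTest ψ ∧ ∫ x in Ioi (0 : ℝ), ψ x = 1 := by
  let β : ContDiffBump (2 : ℝ) := ⟨1 / 2, 1, by norm_num, by norm_num⟩
  have ht : IsTest (β.normed volume) := by
    refine ⟨β.contDiff_normed, β.hasCompactSupport_normed, ?_⟩
    rw [β.tsupport_normed_eq]
    intro x hx
    rw [Metric.mem_closedBall, Real.dist_eq, abs_le] at hx
    rw [mem_Ioi]
    change -1 ≤ x - 2 ∧ _ at hx
    linarith [hx.1]
  refine ⟨_, ht, ?_⟩
  rw [setIntegral_eq_integral_of_forall_compl_eq_zero fun x hx => ht.eq_zero hx]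
  exact β.integral_normed

theorem IsTest.integrable_mul {f φ : ℝ → ℝ} (hφ : IsTest φ)
    (hf : LocallyIntegrableOn f (Ioi (0 : ℝ))) : IntegrableOn (fun x => f x * φ x) (Ioi 0) := by
  have h1 : IntegrableOn f (tsupport φ) := hf.integrableOn_compact_subset hφ.2.2 hφ.2.1.isCompact
  have h2 := h1.mul_continuousOn hφ.1.continuous.continuousOn hφ.2.1.isCompact
  refine (integrableOn_iff_integrable_of_support_subset fun x hx => ?_).1 h2 |>.integrableOn
  exact subset_tsupport _ (right_ne_zero_of_mul hx)

/-- The du Bois-Reymond lemma on the half-line. -/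
theorem ae_eq_const_of_integral_test_deriv_eq_zero {f : ℝ → ℝ}
    (hf : LocallyIntegrableOn f (Ioi (0 : ℝ)))
    (h : ∀ φ, IsTest φ → ∫ x in Ioi (0 : ℝ), f x * deriv φ x = 0) :
    ∃ c : ℝ, ∀ᵐ x ∂(volume.restrict (Ioi (0 : ℝ))), f x = c := by
  obtain ⟨ψ, hψ, hψ1⟩ := exists_test_integral_eq_one
  set c := ∫ x in Ioi (0 : ℝ), f x * ψ x with hc
  have hint : ∀ {φ}, IsTest φ → IntegrableOn φ (Ioi 0) := fun hφ =>
    (hφ.1.continuous.integrable_of_hasCompactSupport hφ.2.1).integrableOn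
  refine ⟨c, ?_⟩
  have hfc : LocallyIntegrableOn (fun x => f x - c) (Ioi (0 : ℝ)) :=
    hf.sub (continuous_const.locallyIntegrable.locallyIntegrableOn _)
  refine (ae_eq_zero_of_integral_test_eq_zero hfc fun φ hφ => ?_).mono fun x hx => sub_eq_zero.1 hx
  set m := ∫ x in Ioi (0 : ℝ), φ x with hm
  have hη : IsTest (fun x => φ x - m * ψ x) := by
    refine ⟨hφ.1.sub (contDiff_const.mul hψ.1), hφ.2.1.sub (hψ.2.1.mul_left), ?_⟩
    refine (tsupport_sub _ _).trans (union_subset hφ.2.2 ?_)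
    exact (tsupport_mul_subset_right).trans hψ.2.2
  obtain ⟨χ, hχ, hχd⟩ := exists_test_deriv_eq hη (by
    rw [integral_sub (hint hφ) ((hint hψ).const_mul m), integral_const_mul, hψ1, mul_one,
      sub_self])
  have h1 := h χ hχ
  rw [hχd] at h1
  have h2 : ∫ x in Ioi (0 : ℝ), f x * (φ x - m * ψ x) =
      (∫ x in Ioi (0 : ℝ), f x * φ x) - m * c := by
    rw [hc, ← integral_const_mul, ← integral_sub (hφ.integrable_mul hf)
      ((hψ.integrable_mul hf).const_mul m)]
    congr 1
    ext x
    ring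
  have h3 : ∫ x in Ioi (0 : ℝ), (f x - c) * φ x = (∫ x in Ioi (0 : ℝ), f x * φ x) - c * m := by
    rw [hm, ← integral_const_mul, ← integral_sub (hφ.integrable_mul hf)
      ((hint hφ).const_mul c)]
    congr 1
    ext x
    ring
  rw [h3]
  rw [h2] at h1
  linarith

/-! ### The Sobolev space on the half-line and traces -/

theorem L2Half.locallyIntegrableOn (f : L2Half) : LocallyIntegrableOn f (Ioi (0 : ℝ)) :=
  locallyIntegrableOn_of_locallyIntegrable_restrict ((Lp.memLp f).locallyIntegrable one_le_two)

theorem L2Half.integrable_mul (f g : L2Half) :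
    IntegrableOn (fun x => f x * g x) (Ioi 0) :=
  (Lp.memLp f).integrable_mul (Lp.memLp g)

theorem L2Half.inner_eq (f g : L2Half) : inner ℝ f g = ∫ x in Ioi (0 : ℝ), f x * g x := by
  rw [L2.inner_def]
  refine integral_congr_ae (Eventually.of_forall fun x => ?_)
  simp [mul_comm]

theorem HasWeakDeriv.unique {f g₁ g₂ : L2Half} (h₁ : HasWeakDeriv f g₁) (h₂ : HasWeakDeriv f g₂) :
    g₁ = g₂ := by
  refine sub_eq_zero.1 (Lp.ext ?_)
  refine EventuallyEq.trans ?_ (Lp.coeFn_zero ℝ 2 _).symm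
  refine ae_eq_zero_of_integral_test_eq_zero (g₁ - g₂).locallyIntegrableOn fun φ hφ => ?_
  have h3 := (hasWeakDeriv_iff _ _).1 h₁ φ hφ
  have h4 := (hasWeakDeriv_iff _ _).1 h₂ φ hφ
  rw [integral_eq_inner hφ.memLp, inner_sub_right]
  linarith

/-- Extension of an element of `L²(0, ∞)` by zero to the real line. -/
def zeroExt (f : L2Half) : ℝ → ℝ := (Ioi (0 : ℝ)).indicator f

theorem zeroExt_ae (f : L2Half) : f =ᵐ[volume.restrict (Ioi (0 : ℝ))] zeroExt f := by
  filter_upwards [ae_restrict_mem measurableSet_Ioi] with x hx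
  exact (indicator_of_mem hx _).symm

theorem locallyIntegrable_zeroExt (f : L2Half) : LocallyIntegrable (zeroExt f) :=
  ((memLp_indicator_iff_restrict measurableSet_Ioi).2 (Lp.memLp f)).locallyIntegrable one_le_two

theorem continuous_primitive_zeroExt (f : L2Half) :
    Continuous fun x : ℝ => ∫ r in (0 : ℝ)..x, zeroExt f r :=
  intervalIntegral.continuous_primitive
    (fun _ _ => ((locallyIntegrable_zeroExt f).integrableOn_isCompact
      isCompact_uIcc).intervalIntegrable) 0

/-- Functions in `H¹(0, ∞)` are primitives of their weak derivatives. -/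
theorem exists_ae_eq_primitive (u : H1Half) :
    ∃ a : ℝ, fn u =ᵐ[volume.restrict (Ioi (0 : ℝ))]
      fun x => a + ∫ r in (0 : ℝ)..x, zeroExt (der u) r := by
  set P : ℝ → ℝ := fun x => ∫ r in (0 : ℝ)..x, zeroExt (der u) r with hP
  have hPc : Continuous P := continuous_primitive_zeroExt _
  have hPl : LocallyIntegrableOn P (Ioi (0 : ℝ)) := hPc.locallyIntegrable.locallyIntegrableOn _
  obtain ⟨c, hc⟩ := ae_eq_const_of_integral_test_deriv_eq_zero
    ((fn u).locallyIntegrableOn.sub hPl) fun φ hφ => by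
    have hu : HasWeakDeriv (fn u) (der u) := u.2
    obtain ⟨a, b, ha, hab⟩ := exists_subset_Icc_of_isCompact hφ.2.1.isCompact hφ.2.2
    set R : ℝ := max b 0 + 1
    have hR0 : 0 < R := by positivity
    have hbR : b < R := (le_max_left b 0).trans_lt (lt_add_one _)
    have hout : ∀ x, b < x → x ∉ tsupport φ := fun x hx h' => (hab h').2.not_gt hx
    have h1 := integral_by_parts (locallyIntegrable_zeroExt (der u))
      (hφ.1.continuous_deriv (by simp)).locallyIntegrable 0 (φ 0) 0 R
    simp only [← contDiff_infty_eq_primitive hφ.1, zero_add, intervalIntegral.integral_same,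
      zero_mul, sub_zero] at h1
    rw [image_eq_zero_of_notMem_tsupport (hout R hbR), mul_zero,
      intervalIntegral.integral_of_le hR0.le] at h1
    have h2 : ∫ x in Ioi (0 : ℝ), (der u x * φ x + P x * deriv φ x) = 0 := by
      refine Eq.trans ?_ h1
      refine Eq.trans (setIntegral_eq_of_subset_of_forall_sdiff_eq_zero (s := Ioc 0 R)
        measurableSet_Ioi Ioc_subset_Ioi_self fun r hr => ?_) ?_
      · have hr' : r ∉ tsupport φ := hout r (hbR.trans (lt_of_not_ge fun h' => hr.2 ⟨hr.1, h'⟩))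
        rw [image_eq_zero_of_notMem_tsupport hr',
          image_eq_zero_of_notMem_tsupport fun h' => hr' (tsupport_deriv_subset h'), mul_zero,
          mul_zero, add_zero]
      · refine setIntegral_congr_fun measurableSet_Ioc fun r hr => ?_
        simp only [zeroExt, indicator_of_mem (show r ∈ Ioi (0 : ℝ) from hr.1), hP]
    rw [integral_add (hφ.integrable_mul (der u).locallyIntegrableOn)
      (hφ.deriv.integrable_mul hPl)] at h2
    have h3 := hu φ hφ
    simp only [Pi.sub_apply, sub_mul]
    rw [integral_sub (hφ.deriv.integrable_mul (fn u).locallyIntegrableOn)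
      (hφ.deriv.integrable_mul hPl), h3]
    linarith
  exact ⟨c, hc.mono fun x hx => by rw [Pi.sub_apply, sub_eq_iff_eq_add] at hx; exact hx⟩

/-- The continuous representative of `u ∈ H¹(0, ∞)`, extended to `(-∞, 0]` by its value at `0`. -/
def rep (u : H1Half) (x : ℝ) : ℝ :=
  (exists_ae_eq_primitive u).choose + ∫ r in (0 : ℝ)..x, zeroExt (der u) r

theorem rep_zero (u : H1Half) : rep u 0 = (exists_ae_eq_primitive u).choose := by simp [rep]

theorem rep_eq (u : H1Half) (x : ℝ) : rep u x = rep u 0 + ∫ r in (0 : ℝ)..x, zeroExt (der u) r := by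
  rw [rep_zero]
  rfl

theorem fn_ae_eq_rep (u : H1Half) : fn u =ᵐ[volume.restrict (Ioi (0 : ℝ))] rep u :=
  (exists_ae_eq_primitive u).choose_spec

theorem continuous_rep (u : H1Half) : Continuous (rep u) :=
  continuous_const.add (continuous_primitive_zeroExt _)

theorem rep_of_nonpos (u : H1Half) {x : ℝ} (hx : x ≤ 0) : rep u x = rep u 0 := by
  rw [rep_eq, add_eq_left]
  refine intervalIntegral.integral_zero_ae (Eventually.of_forall fun r hr => ?_)
  rw [uIoc_of_ge hx] at hr
  exact indicator_of_notMem (not_lt.2 hr.2) _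

theorem eq_rep_of_ae_eq (u : H1Half) {g : ℝ → ℝ} (hg : Continuous g) (hg0 : ∀ x ≤ 0, g x = g 0)
    (h : fn u =ᵐ[volume.restrict (Ioi (0 : ℝ))] g) : rep u = g := by
  have h1 : EqOn (rep u) g (Ioi 0) := by
    have h1 : rep u =ᵐ[volume.restrict (Ioi (0 : ℝ))] g := (fn_ae_eq_rep u).symm.trans h
    exact Measure.eqOn_open_of_ae_eq h1 isOpen_Ioi (continuous_rep u).continuousOn hg.continuousOn
  have h2 : EqOn (rep u) g (Ici 0) := by
    have := h1.closure (continuous_rep u) hg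
    rwa [closure_Ioi] at this
  ext x
  rcases le_total 0 x with hx | hx
  · exact h2 hx
  · rw [rep_of_nonpos u hx, hg0 x hx, h2 self_mem_Ici]

/-- Integration by parts on `(x, ∞)`: functions in `H¹` vanish at infinity. -/
theorem rep_mul_rep (u w : H1Half) {x : ℝ} (hx : 0 ≤ x) :
    rep u x * rep w x = -∫ s in Ioi x, (der u s * fn w s + fn u s * der w s) := by
  have hI : IntegrableOn (fun s => der u s * fn w s + fn u s * der w s) (Ioi 0) :=
    (L2Half.integrable_mul _ _).add (L2Half.integrable_mul _ _)
  have hparts : ∀ R, x ≤ R → ∫ s in x..R, (der u s * fn w s + fn u s * der w s) =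
      rep u R * rep w R - rep u x * rep w x := fun R hR => by
    have h1 := integral_by_parts (locallyIntegrable_zeroExt (der u))
      (locallyIntegrable_zeroExt (der w)) (rep u 0) (rep w 0) x R
    simp only [← rep_eq] at h1
    rw [← h1]
    refine intervalIntegral.integral_congr_ae ?_
    rw [uIoc_of_le hR]
    have h2 : ∀ᵐ s ∂(volume.restrict (Ioi (0 : ℝ))), der u s * fn w s + fn u s * der w s =
        zeroExt (der u) s * rep w s + rep u s * zeroExt (der w) s := by
      filter_upwards [zeroExt_ae (der u), zeroExt_ae (der w), fn_ae_eq_rep u, fn_ae_eq_rep w]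
        with s h1 h2 h3 h4
      rw [h1, h2, h3, h4]
    filter_upwards [(ae_restrict_iff' measurableSet_Ioi).1 h2] with s hs hsx
    exact hs (hx.trans_lt hsx.1)
  have hIx := hI.mono_set (Ioi_subset_Ioi hx)
  have hlim := (intervalIntegral_tendsto_integral_Ioi x hIx tendsto_id).add_const
    (rep u x * rep w x)
  have hlim2 : Tendsto (fun R => rep u R * rep w R) atTop
      (𝓝 ((∫ s in Ioi x, (der u s * fn w s + fn u s * der w s)) + rep u x * rep w x)) := by
    refine hlim.congr' ?_
    filter_upwards [eventually_ge_atTop x] with R hR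
    simp only [id]
    rw [hparts R hR, sub_add_cancel]
  have hint : IntegrableAtFilter (fun R => rep u R * rep w R) atTop volume := by
    refine ⟨Ioi 0, Ioi_mem_atTop 0, ?_⟩
    refine (L2Half.integrable_mul (fn u) (fn w)).congr ?_
    filter_upwards [fn_ae_eq_rep u, fn_ae_eq_rep w] with s h3 h4
    rw [h3, h4]
  have := hint.eq_zero_of_tendsto (fun s hs => by
    obtain ⟨b, hb⟩ := mem_atTop_sets.1 hs
    exact measure_mono_top (s₁ := Ici b) (fun y hy => hb y hy) Real.volume_Ici) hlim2
  linarith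

theorem rep_zero_mul_rep_zero (u w : H1Half) :
    rep u 0 * rep w 0 = -(inner ℝ (der u) (fn w) + inner ℝ (fn u) (der w)) := by
  rw [rep_mul_rep u w le_rfl, L2Half.inner_eq, L2Half.inner_eq,
    integral_add (L2Half.integrable_mul _ _) (L2Half.integrable_mul _ _)]

theorem norm_sq_eq_integral (f : L2Half) : ‖f‖ ^ 2 = ∫ x in Ioi (0 : ℝ), f x ^ 2 := by
  rw [← real_inner_self_eq_norm_sq, L2Half.inner_eq]
  simp only [pow_two]

/-- Pointwise values are controlled by the `L²` norm and an arbitrarily small part of the Dirichlet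
integral. -/
theorem rep_sq_le (u : H1Half) {δ : ℝ} (hδ : 0 < δ) (x : ℝ) :
    rep u x ^ 2 ≤ δ * ‖der u‖ ^ 2 + δ⁻¹ * ‖fn u‖ ^ 2 := by
  wlog hx : 0 ≤ x generalizing x
  · rw [rep_of_nonpos u (not_le.1 hx).le]
    exact this 0 le_rfl
  have hsq : ∀ f : L2Half, IntegrableOn (fun s => f s ^ 2) (Ioi 0) := fun f => by
    simpa only [pow_two] using L2Half.integrable_mul f f
  have hI : IntegrableOn (fun s => δ * der u s ^ 2 + δ⁻¹ * fn u s ^ 2) (Ioi 0) :=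
    ((hsq _).const_mul δ).add ((hsq _).const_mul δ⁻¹)
  have hJ : IntegrableOn (fun s => der u s * fn u s + fn u s * der u s) (Ioi 0) :=
    (L2Half.integrable_mul _ _).add (L2Half.integrable_mul _ _)
  rw [norm_sq_eq_integral, norm_sq_eq_integral, ← integral_const_mul, ← integral_const_mul,
    ← integral_add ((hsq _).const_mul δ) ((hsq _).const_mul δ⁻¹), pow_two, rep_mul_rep u u hx,
    ← integral_neg]
  calc ∫ s in Ioi x, -(der u s * fn u s + fn u s * der u s)
      ≤ ∫ s in Ioi x, (δ * der u s ^ 2 + δ⁻¹ * fn u s ^ 2) := by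
        refine setIntegral_mono (hJ.mono_set (Ioi_subset_Ioi hx)).neg
          (hI.mono_set (Ioi_subset_Ioi hx)) fun s => ?_
        have h1 : δ * der u s ^ 2 + δ⁻¹ * fn u s ^ 2 + (der u s * fn u s + fn u s * der u s) =
            δ * (der u s + δ⁻¹ * fn u s) ^ 2 := by
          field_simp
          ring
        have h2 : 0 ≤ δ * (der u s + δ⁻¹ * fn u s) ^ 2 := by positivity
        linarith
    _ ≤ ∫ s in Ioi (0 : ℝ), (δ * der u s ^ 2 + δ⁻¹ * fn u s ^ 2) :=
        setIntegral_mono_set hI (Eventually.of_forall fun s => by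
          simp only [Pi.zero_apply]; positivity)
          (Ioi_subset_Ioi hx).eventuallyLE

/-- `u ↦ u` as a bounded operator from `H¹(0, ∞)` to `L²(0, ∞)`. -/
def fnL : H1Half →L[ℝ] L2Half :=
  (WithLp.fstL 2 ℝ L2Half L2Half).comp H1Half.subtypeL

/-- `u ↦ u'` as a bounded operator from `H¹(0, ∞)` to `L²(0, ∞)`. -/
def derL : H1Half →L[ℝ] L2Half :=
  (WithLp.sndL 2 ℝ L2Half L2Half).comp H1Half.subtypeL

@[simp] theorem fnL_apply (u : H1Half) : fnL u = fn u := rfl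

@[simp] theorem derL_apply (u : H1Half) : derL u = der u := rfl

theorem H1Half.norm_sq (u : H1Half) : ‖u‖ ^ 2 = ‖fn u‖ ^ 2 + ‖der u‖ ^ 2 :=
  WithLp.prod_norm_sq_eq_of_L2 (u : WithLp 2 (L2Half × L2Half))

theorem abs_rep_le (u : H1Half) (x : ℝ) : ‖rep u x‖ ≤ ‖u‖ := by
  have h1 := rep_sq_le u one_pos x
  rw [inv_one, one_mul, one_mul, add_comm, ← H1Half.norm_sq] at h1
  exact abs_le_of_sq_le_sq h1 (norm_nonneg u)

/-- The Sobolev embedding of `H¹(0, ∞)` into the bounded continuous functions. -/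
def repL : H1Half →L[ℝ] BoundedContinuousFunction ℝ ℝ :=
  LinearMap.mkContinuous
    { toFun := fun u =>
        BoundedContinuousFunction.ofNormedAddCommGroup (rep u) (continuous_rep u) ‖u‖ (abs_rep_le u)
      map_add' := fun u w => by
        ext x
        refine congr_fun (eq_rep_of_ae_eq (u + w) (g := rep u + rep w)
          ((continuous_rep u).add (continuous_rep w))
          (fun x hx => by simp only [Pi.add_apply, rep_of_nonpos _ hx]) ?_) x
        exact (Lp.coeFn_add (fn u) (fn w)).trans ((fn_ae_eq_rep u).add (fn_ae_eq_rep w))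
      map_smul' := fun r u => by
        ext x
        refine congr_fun (eq_rep_of_ae_eq (r • u) (g := r • rep u)
          ((continuous_rep u).const_smul r)
          (fun x hx => by simp only [Pi.smul_apply, rep_of_nonpos _ hx]) ?_) x
        exact (Lp.coeFn_smul r (fn u)).trans ((fn_ae_eq_rep u).const_smul r) } 1 fun u => by
    rw [one_mul]
    exact BoundedContinuousFunction.norm_ofNormedAddCommGroup_le (continuous_rep u)
      (norm_nonneg u) (abs_rep_le u)

@[simp] theorem repL_apply (u : H1Half) (x : ℝ) : repL u x = rep u x := rfl

/-- The trace `u ↦ u(0+)`. -/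
def trace : H1Half →L[ℝ] ℝ := (BoundedContinuousFunction.evalCLM ℝ (0 : ℝ)).comp repL

theorem trace_apply (u : H1Half) : trace u = rep u 0 := rfl

/-- `HasTrace` determines the boundary value uniquely, and every element of `H¹(0, ∞)` has one. -/
theorem hasTrace_fn_iff (u : H1Half) (a : ℝ) : HasTrace (fn u) a ↔ a = trace u := by
  refine ⟨?_, ?_⟩
  · rintro ⟨g, hg, hlim⟩
    have h1 : ∀ᵐ x, x ∈ Ioi (0 : ℝ) → g x = rep u x :=
      (ae_restrict_iff' measurableSet_Ioi).1 (hg.symm.trans (fn_ae_eq_rep u))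
    refine tendsto_nhds_unique_of_frequently_eq hlim
      ((continuous_rep u).tendsto 0 |>.mono_left nhdsWithin_le_nhds) fun hne => ?_
    obtain ⟨δ, hδ, hsub⟩ := mem_nhdsGT_iff_exists_Ioo_subset.1 hne
    have h2 : volume (Ioo (0 : ℝ) δ) = 0 :=
      measure_mono_null (t := {x | ¬(x ∈ Ioi (0 : ℝ) → g x = rep u x)})
        (fun x hx h' => hsub hx (h' hx.1)) (ae_iff.1 h1)
    rw [Real.volume_Ioo, sub_zero, ENNReal.ofReal_eq_zero] at h2
    exact not_lt.2 h2 hδ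
  · rintro rfl
    exact ⟨rep u, fn_ae_eq_rep u, (continuous_rep u).tendsto 0 |>.mono_left nhdsWithin_le_nhds⟩

/-- The restriction to `(0, ∞)` of a test function on the real line. -/
theorem exists_H1Half_of_contDiff {φ : ℝ → ℝ} (hφ : ContDiff ℝ ∞ φ) (hs : HasCompactSupport φ) :
    ∃ u : H1Half, fn u =ᵐ[volume.restrict (Ioi (0 : ℝ))] φ ∧
      der u =ᵐ[volume.restrict (Ioi (0 : ℝ))] deriv φ ∧ trace u = φ 0 := by
  have hm : MemLp φ 2 (volume.restrict (Ioi (0 : ℝ))) :=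
    (hφ.continuous.memLp_of_hasCompactSupport hs).restrict _
  have hm' : MemLp (deriv φ) 2 (volume.restrict (Ioi (0 : ℝ))) :=
    ((hφ.continuous_deriv (by simp)).memLp_of_hasCompactSupport hs.deriv).restrict _
  have hw : HasWeakDeriv (hm.toLp φ) (hm'.toLp (deriv φ)) := by
    intro ψ hψ
    have hdiff := hφ.differentiable (by simp)
    have hψdiff := hψ.1.differentiable (by simp)
    have hcd := hφ.continuous_deriv (by simp)
    have hψcd := hψ.1.continuous_deriv (by simp)
    have h1 := integral_mul_deriv_eq_deriv_mul_of_integrable (u := φ) (v := ψ) (u' := deriv φ)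
      (v' := deriv ψ) (fun x _ => (hdiff x).hasDerivAt) (fun x _ => (hψdiff x).hasDerivAt)
      ((hφ.continuous.mul hψcd).integrable_of_hasCompactSupport hψ.2.1.deriv.mul_left)
      ((hcd.mul hψ.1.continuous).integrable_of_hasCompactSupport hψ.2.1.mul_left)
      ((hφ.continuous.mul hψ.1.continuous).integrable_of_hasCompactSupport hψ.2.1.mul_left)
    have h2 : ∫ x in Ioi (0 : ℝ), φ x * deriv ψ x = ∫ x, φ x * deriv ψ x :=
      setIntegral_eq_integral_of_forall_compl_eq_zero fun x hx => by
        rw [hψ.deriv.eq_zero hx, mul_zero]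
    have h3 : ∫ x in Ioi (0 : ℝ), deriv φ x * ψ x = ∫ x, deriv φ x * ψ x :=
      setIntegral_eq_integral_of_forall_compl_eq_zero fun x hx => by
        rw [hψ.eq_zero hx, mul_zero]
    rw [← h2, ← h3] at h1
    have h4 : ∫ x in Ioi (0 : ℝ), hm.toLp φ x * deriv ψ x = ∫ x in Ioi (0 : ℝ), φ x * deriv ψ x :=
      integral_congr_ae (hm.coeFn_toLp.mul (EventuallyEq.refl _ (deriv ψ)))
    have h5 : ∫ x in Ioi (0 : ℝ), hm'.toLp (deriv φ) x * ψ x =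
        ∫ x in Ioi (0 : ℝ), deriv φ x * ψ x :=
      integral_congr_ae (hm'.coeFn_toLp.mul (EventuallyEq.refl _ ψ))
    rw [h4, h5]
    exact h1
  let u : H1Half := ⟨WithLp.toLp 2 (hm.toLp φ, hm'.toLp (deriv φ)), hw⟩
  refine ⟨u, hm.coeFn_toLp, hm'.coeFn_toLp, ?_⟩
  refine ((hasTrace_fn_iff u (φ 0)).1 ⟨φ, hm.coeFn_toLp, ?_⟩).symm
  exact (hφ.continuous.tendsto 0).mono_left nhdsWithin_le_nhds

/-! ### The sine as a superposition operator -/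

theorem hasFDerivAt_of_quadratic {E F : Type*} [NormedAddCommGroup E] [NormedSpace ℝ E]
    [NormedAddCommGroup F] [NormedSpace ℝ F] {f : E → F} {f' : E →L[ℝ] F} {x : E}
    (h : ∀ k, ‖f (x + k) - f x - f' k‖ ≤ ‖k‖ ^ 2) : HasFDerivAt f f' x := by
  rw [hasFDerivAt_iff_isLittleO_nhds_zero]
  refine Asymptotics.IsBigO.trans_isLittleO (g := fun k : E => ‖k‖ ^ 2)
    (Asymptotics.isBigO_of_le _ fun k => ?_) (Asymptotics.isLittleO_norm_pow_id one_lt_two)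
  rw [norm_pow, norm_norm]
  exact h k

theorem abs_sin_add_sub_le (a k : ℝ) :
    |Real.sin (a + k) - Real.sin a - Real.cos a * k| ≤ k ^ 2 := by
  have h1 : ∀ y ∈ segment ℝ a (a + k), ‖Real.cos y - Real.cos a‖ ≤ |k| := by
    intro y hy
    rw [segment_eq_image'] at hy
    obtain ⟨s, hs, rfl⟩ := hy
    refine (Real.lipschitzWith_cos.norm_sub_le _ _).trans ?_
    rw [NNReal.coe_one, one_mul, add_sub_cancel_left, add_sub_cancel_left, norm_smul,
      Real.norm_of_nonneg hs.1, Real.norm_eq_abs]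
    exact mul_le_of_le_one_left (abs_nonneg k) hs.2
  have h2 := (convex_segment a (a + k)).norm_image_sub_le_of_norm_hasDerivWithin_le
    (f := fun y => Real.sin y - Real.cos a * y) (f' := fun y => Real.cos y - Real.cos a)
    (C := |k|)
    (fun y _ => ((Real.hasDerivAt_sin y).sub
      (((hasDerivAt_id y).const_mul (Real.cos a)).congr_deriv (mul_one _))).hasDerivWithinAt) h1
    (left_mem_segment ℝ _ _) (right_mem_segment ℝ _ _)
  rw [add_sub_cancel_left, Real.norm_eq_abs, Real.norm_eq_abs, ← pow_two, sq_abs] at h2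
  refine le_trans (le_of_eq ?_) h2
  congr 1
  ring

theorem abs_cos_add_sub_le (a k : ℝ) :
    |Real.cos (a + k) - Real.cos a + Real.sin a * k| ≤ k ^ 2 := by
  have h := abs_sin_add_sub_le (a + Real.pi / 2) k
  rw [add_right_comm, Real.sin_add_pi_div_two, Real.sin_add_pi_div_two,
    Real.cos_add_pi_div_two] at h
  rwa [neg_mul, sub_neg_eq_add] at h

theorem memLp_bounded_mul (b : BoundedContinuousFunction ℝ ℝ) (f : L2Half) :
    MemLp (fun x => b x * f x) 2 (volume.restrict (Ioi (0 : ℝ))) :=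
  (Lp.memLp f).of_le_mul (c := ‖b‖)
    (b.continuous.aestronglyMeasurable.mul (Lp.aestronglyMeasurable f))
    (Eventually.of_forall fun x => by
      rw [norm_mul]
      exact mul_le_mul_of_nonneg_right (b.norm_coe_le_norm x) (norm_nonneg _))

/-- Multiplication of `L²` functions by bounded continuous functions. -/
def mulL : BoundedContinuousFunction ℝ ℝ →L[ℝ] L2Half →L[ℝ] L2Half :=
  LinearMap.mkContinuous₂
    (LinearMap.mk₂ ℝ (fun b f => (memLp_bounded_mul b f).toLp _)
      (fun b₁ b₂ f => by
        rw [← MemLp.toLp_add]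
        refine MemLp.toLp_congr _ _ (Eventually.of_forall fun x => ?_)
        simp [add_mul])
      (fun r b f => by
        rw [← MemLp.toLp_const_smul]
        refine MemLp.toLp_congr _ _ (Eventually.of_forall fun x => ?_)
        simp [mul_assoc])
      (fun b f₁ f₂ => by
        rw [← MemLp.toLp_add]
        refine MemLp.toLp_congr _ _ ?_
        filter_upwards [Lp.coeFn_add f₁ f₂] with x hx
        rw [hx, Pi.add_apply, mul_add]
        rfl)
      (fun r b f => by
        rw [← MemLp.toLp_const_smul]
        refine MemLp.toLp_congr _ _ ?_
        filter_upwards [Lp.coeFn_smul r f] with x hx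
        simp [hx, mul_left_comm])) 1 fun b f => by
    rw [one_mul]
    refine Lp.norm_le_mul_norm_of_ae_le_mul ?_
    filter_upwards [(memLp_bounded_mul b f).coeFn_toLp] with x hx
    rw [LinearMap.mk₂_apply, hx, norm_mul]
    exact mul_le_mul_of_nonneg_right (b.norm_coe_le_norm x) (norm_nonneg _)

theorem mulL_ae (b : BoundedContinuousFunction ℝ ℝ) (f : L2Half) :
    mulL b f =ᵐ[volume.restrict (Ioi (0 : ℝ))] fun x => b x * f x :=
  (memLp_bounded_mul b f).coeFn_toLp

theorem hasFDerivAt_cos_comp (f : BoundedContinuousFunction ℝ ℝ) :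
    HasFDerivAt (fun f => BoundedContinuousFunction.comp Real.cos Real.lipschitzWith_cos f)
      (-(ContinuousLinearMap.mul ℝ (BoundedContinuousFunction ℝ ℝ)
        (BoundedContinuousFunction.comp Real.sin lipschitzWith_sin f))) f := by
  refine hasFDerivAt_of_quadratic fun k => ?_
  refine (BoundedContinuousFunction.norm_le (by positivity)).2 fun x => ?_
  have h1 := abs_cos_add_sub_le (f x) (k x)
  have h2 : k x ^ 2 ≤ ‖k‖ ^ 2 := by
    rw [← sq_abs]
    exact pow_le_pow_left₀ (abs_nonneg _) (k.norm_coe_le_norm x) 2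
  refine le_trans (le_of_eq ?_) (h1.trans h2)
  rw [Real.norm_eq_abs]
  congr 1
  simp

theorem contDiff_cos_comp :
    ContDiff ℝ 1 fun f : BoundedContinuousFunction ℝ ℝ =>
      BoundedContinuousFunction.comp Real.cos Real.lipschitzWith_cos f := by
  refine (contDiff_succ_iff_hasFDerivAt (n := 0)).2 ⟨_, ?_, hasFDerivAt_cos_comp⟩
  rw [Nat.cast_zero, contDiff_zero]
  exact ((ContinuousLinearMap.mul ℝ _).continuous.comp
    (BoundedContinuousFunction.continuous_comp lipschitzWith_sin)).neg

/-- The superposition operator `u ↦ sin u` from `H¹(0, ∞)` to `L²(0, ∞)`. -/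
def sinOp (u : H1Half) : L2Half := lipschitzWith_sin.compLp Real.sin_zero (fn u)

/-- The derivative of `u ↦ sin u` at `u` is the multiplication by `cos u`. The remainder is at most
`|k|²` pointwise, and one factor `|k|` is bounded by the `H¹` norm of `k`. -/
theorem hasFDerivAt_sinOp (u : H1Half) :
    HasFDerivAt sinOp
      ((mulL (BoundedContinuousFunction.comp Real.cos Real.lipschitzWith_cos
        (repL u))).comp fnL) u := by
  refine hasFDerivAt_of_quadratic fun k => ?_
  have h1 : ‖sinOp (u + k) - sinOp u -
      mulL (BoundedContinuousFunction.comp Real.cos Real.lipschitzWith_cos (repL u)) (fn k)‖ ≤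
      ‖k‖ * ‖fn k‖ := by
    refine Lp.norm_le_mul_norm_of_ae_le_mul ?_
    filter_upwards [Lp.coeFn_sub (sinOp (u + k) - sinOp u)
        (mulL (BoundedContinuousFunction.comp Real.cos Real.lipschitzWith_cos (repL u)) (fn k)),
      Lp.coeFn_sub (sinOp (u + k)) (sinOp u),
      mulL_ae (BoundedContinuousFunction.comp Real.cos Real.lipschitzWith_cos (repL u)) (fn k),
      lipschitzWith_sin.coeFn_compLp Real.sin_zero (fn u),
      lipschitzWith_sin.coeFn_compLp Real.sin_zero (fn (u + k)),
      Lp.coeFn_add (fn u) (fn k), fn_ae_eq_rep u, fn_ae_eq_rep k] with x h1 h2 h3 h4 h5 h6 h7 h8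
    have h4' : sinOp u x = Real.sin (fn u x) := h4
    have h5' : sinOp (u + k) x = Real.sin (fn u x + fn k x) := by
      refine h5.trans (congrArg Real.sin ?_)
      exact h6
    rw [h1, Pi.sub_apply, h2, Pi.sub_apply, h3, h4', h5', Real.norm_eq_abs,
      BoundedContinuousFunction.comp_apply, repL_apply, ← h7]
    refine (abs_sin_add_sub_le _ _).trans ?_
    rw [← sq_abs, pow_two, Real.norm_eq_abs]
    refine mul_le_mul_of_nonneg_right ?_ (abs_nonneg _)
    rw [h8]
    exact abs_rep_le k x
  refine h1.trans ?_
  rw [pow_two]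
  refine mul_le_mul_of_nonneg_left ?_ (norm_nonneg k)
  refine abs_le_of_sq_le_sq ?_ (norm_nonneg k) |> (le_abs_self _).trans
  rw [H1Half.norm_sq]
  exact le_add_of_nonneg_right (sq_nonneg _)

theorem contDiff_sinOp : ContDiff ℝ 2 sinOp := by
  refine (contDiff_succ_iff_hasFDerivAt (n := 1)).2 ⟨_, ?_, hasFDerivAt_sinOp⟩
  have h1 := mulL.contDiff.comp (contDiff_cos_comp.comp repL.contDiff)
  have h2 : ContDiff ℝ 1 fun u : H1Half => (mulL
      (BoundedContinuousFunction.comp Real.cos Real.lipschitzWith_cos (repL u))).comp fnL :=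
    h1.clm_comp contDiff_const
  exact_mod_cast h2

theorem norm_sinOp_sub_le (u w : H1Half) : ‖sinOp u - sinOp w‖ ≤ ‖fn u - fn w‖ := by
  have h := lipschitzWith_sin.norm_compLp_sub_le Real.sin_zero (fn u) (fn w)
  rwa [NNReal.coe_one, one_mul] at h

section Junction

/-! ### The energy form of the junction -/

local instance : NormedSpace ℝ H1Half := Submodule.normedSpace H1Half

local instance : InnerProductSpace ℝ H1Half := Submodule.innerProductSpace H1Half

local instance : NormedSpace ℝ H1Y := PiLp.normedSpace 2 ℝ _

local instance : InnerProductSpace ℝ H1Y := PiLp.innerProductSpace _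

/-- The bounded bilinear form `(x, y) ↦ ⟪A x, A y⟫`. -/
def innerForm {V E : Type*} [NormedAddCommGroup V] [NormedSpace ℝ V] [NormedAddCommGroup E]
    [InnerProductSpace ℝ E] (A : V →L[ℝ] E) : V →L[ℝ] V →L[ℝ] ℝ :=
  LinearMap.mkContinuous₂
    (LinearMap.mk₂ ℝ (fun x y => inner ℝ (A x) (A y))
      (fun x y z => by rw [map_add, inner_add_left])
      (fun r x y => by rw [map_smul, real_inner_smul_left, smul_eq_mul])
      (fun x y z => by rw [map_add, inner_add_right])
      (fun r x y => by rw [map_smul, real_inner_smul_right, smul_eq_mul])) (‖A‖ * ‖A‖) fun x y => by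
    calc ‖inner ℝ (A x) (A y)‖ ≤ ‖A x‖ * ‖A y‖ := norm_inner_le_norm _ _
      _ ≤ (‖A‖ * ‖x‖) * (‖A‖ * ‖y‖) := by gcongr <;> exact A.le_opNorm _
      _ = ‖A‖ * ‖A‖ * ‖x‖ * ‖y‖ := by ring

@[simp] theorem innerForm_apply {V E : Type*} [NormedAddCommGroup V] [NormedSpace ℝ V]
    [NormedAddCommGroup E] [InnerProductSpace ℝ E] (A : V →L[ℝ] E) (x y : V) :
    innerForm A x y = inner ℝ (A x) (A y) := rfl

/-- The functional `u ↦ ∑ⱼ cⱼ uⱼ(0+)` on `H¹(𝒴)`. -/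
def vertexSum (c : Fin 3 → ℝ) : H1Y →L[ℝ] ℝ :=
  ∑ j, c j • trace.comp (PiLp.proj 2 (fun _ : Fin 3 => H1Half) j)

theorem vertexSum_apply (c : Fin 3 → ℝ) (u : H1Y) : vertexSum c u = ∑ j, c j * trace (u j) := by
  simp [vertexSum]

/-- A number `M` such that `𝒯 + M` is positive; its size is dictated by `ellForm_coercive`. -/
def shift (c : Fin 3 → ℝ) (lam : ℝ) : ℝ :=
  1 + 18 * (|lam⁻¹| * (|lam⁻¹| + 1)) * ∑ j, c j ^ 2

/-- The quadratic form of the operator `𝒯 + shift`, in polarized form. For `lam = 0` the vertex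
term drops out, as `lam⁻¹ = 0`; the form is then to be restricted to `{vertexSum = 0}`. -/
def ellForm (c : Fin 3 → ℝ) (lam : ℝ) : H1Y →L[ℝ] H1Y →L[ℝ] ℝ :=
  (∑ j, (c j ^ 2 • innerForm (derL.comp (PiLp.proj 2 (fun _ : Fin 3 => H1Half) j)) +
    shift c lam • innerForm (fnL.comp (PiLp.proj 2 (fun _ : Fin 3 => H1Half) j)))) +
    lam⁻¹ • innerForm (vertexSum c)

theorem ellForm_apply (c : Fin 3 → ℝ) (lam : ℝ) (u φ : H1Y) :
    ellForm c lam u φ = ∑ j, (c j ^ 2 * inner ℝ (der (u j)) (der (φ j)) +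
      shift c lam * inner ℝ (fn (u j)) (fn (φ j))) +
      lam⁻¹ * (vertexSum c u * vertexSum c φ) := by
  simp [ellForm, mul_comm]

theorem H1Y.norm_sq (u : H1Y) : ‖u‖ ^ 2 = ∑ j, (‖fn (u j)‖ ^ 2 + ‖der (u j)‖ ^ 2) := by
  rw [PiLp.norm_sq_eq_of_L2]
  exact Finset.sum_congr rfl fun j _ => H1Half.norm_sq (u j)

/-- The form `ellForm` is coercive: the trace terms are absorbed by the Dirichlet integral and the
shift. -/
theorem ellForm_coercive {c : Fin 3 → ℝ} (hc : ∀ j, 0 < c j) (lam : ℝ) :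
    ∃ m : ℝ, 0 < m ∧ m ≤ 1 ∧ ∀ u, m * ‖u‖ ^ 2 ≤ ellForm c lam u u := by
  set σ := |lam⁻¹| with hσ
  have hσ0 : 0 ≤ σ := abs_nonneg _
  obtain ⟨i, -, hi⟩ := Finset.exists_min_image Finset.univ c Finset.univ_nonempty
  refine ⟨min 1 (c i ^ 2 / 2), lt_min one_pos (half_pos (pow_pos (hc i) 2)), min_le_left _ _,
    fun u => ?_⟩
  set m := min 1 (c i ^ 2 / 2)
  have hmj : ∀ j, m ≤ c j ^ 2 / 2 := fun j =>
    (min_le_right _ _).trans (by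
      have := pow_le_pow_left₀ (hc i).le (hi j (Finset.mem_univ j)) 2
      linarith)
  have hm1 : m ≤ 1 := min_le_left _ _
  -- With this weight in `rep_sq_le`, half of the Dirichlet integral absorbs the vertex term, whose
  -- coefficient is at most `3 * σ * c j ^ 2` for each edge.
  have hδ : 0 < 1 / (6 * (σ + 1)) := by positivity
  have hτ : vertexSum c u ^ 2 ≤ 3 * ∑ j, (c j * trace (u j)) ^ 2 := by
    rw [vertexSum_apply]
    have := sq_sum_le_card_mul_sum_sq (s := Finset.univ) (f := fun j => c j * trace (u j))
    simpa using this
  have hσδ : 3 * σ * (1 / (6 * (σ + 1))) ≤ 1 / 2 := by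
    rw [mul_one_div, div_le_div_iff₀ (by positivity) (by norm_num)]
    linarith
  have hj : ∀ j, m * (‖fn (u j)‖ ^ 2 + ‖der (u j)‖ ^ 2) + 3 * σ * (c j * trace (u j)) ^ 2 ≤
      c j ^ 2 * ‖der (u j)‖ ^ 2 + shift c lam * ‖fn (u j)‖ ^ 2 := fun j => by
    have h1 : trace (u j) ^ 2 ≤ _ := rep_sq_le (u j) hδ 0
    rw [one_div, inv_inv] at h1
    have hcj : c j ^ 2 ≤ ∑ k, c k ^ 2 :=
      Finset.single_le_sum (fun k _ => sq_nonneg (c k)) (Finset.mem_univ j)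
    have h2 : 1 + 3 * σ * (6 * (σ + 1)) * c j ^ 2 ≤ shift c lam := by
      rw [shift, ← hσ]
      have := mul_le_mul_of_nonneg_left hcj (by positivity : 0 ≤ 18 * (σ * (σ + 1)))
      linarith
    have h3 : 3 * σ * (c j * trace (u j)) ^ 2 ≤
        1 / 2 * c j ^ 2 * ‖der (u j)‖ ^ 2 + 3 * σ * (6 * (σ + 1)) * c j ^ 2 * ‖fn (u j)‖ ^ 2 := by
      have h4 := mul_le_mul_of_nonneg_left h1 (by positivity : 0 ≤ 3 * σ * c j ^ 2)
      have h5 := mul_le_mul_of_nonneg_right hσδ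
        (by positivity : 0 ≤ c j ^ 2 * ‖der (u j)‖ ^ 2)
      rw [one_div] at h5
      nlinarith
    have h6 := mul_le_mul_of_nonneg_right h2 (sq_nonneg ‖fn (u j)‖)
    have h7 := mul_le_mul_of_nonneg_right (hmj j) (sq_nonneg ‖der (u j)‖)
    have h8 := mul_le_mul_of_nonneg_right hm1 (sq_nonneg ‖fn (u j)‖)
    linarith
  have hsum := Finset.sum_le_sum fun j (_ : j ∈ Finset.univ) => hj j
  rw [Finset.sum_add_distrib, ← Finset.mul_sum, ← Finset.mul_sum, ← H1Y.norm_sq] at hsum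
  rw [ellForm_apply]
  simp only [real_inner_self_eq_norm_sq]
  have h9 : -(σ * vertexSum c u ^ 2) ≤ lam⁻¹ * (vertexSum c u * vertexSum c u) := by
    rw [← pow_two, ← neg_mul]
    exact mul_le_mul_of_nonneg_right (neg_abs_le _) (sq_nonneg _)
  have h10 := mul_le_mul_of_nonneg_left hτ hσ0
  linarith

theorem mem_dataSpace_iff (c : Fin 3 → ℝ) (lam : ℝ) (w : Phase) :
    w ∈ dataSpace c lam ↔ (lam = 0 → vertexSum c w.fst = 0) := by
  refine forall_congr' fun _ => ⟨?_, fun h => ⟨fun j => trace (w.fst j), fun j => ?_, ?_⟩⟩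
  · rintro ⟨a, ha, hs⟩
    rw [vertexSum_apply]
    refine Eq.trans ?_ hs
    exact Finset.sum_congr rfl fun j _ => by rw [(hasTrace_fn_iff _ _).1 (ha j)]
  · exact (hasTrace_fn_iff _ _).2 rfl
  · rw [← vertexSum_apply, h]

theorem isClosed_dataSpace (c : Fin 3 → ℝ) (lam : ℝ) :
    IsClosed (dataSpace c lam : Set Phase) := by
  have : (dataSpace c lam : Set Phase) =
      ⋂ _ : lam = 0, {w | ((vertexSum c).comp (WithLp.fstL 2 ℝ H1Y L2Y)) w = 0} := by
    ext w
    simp only [SetLike.mem_coe, mem_dataSpace_iff, mem_iInter]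
    rfl
  rw [this]
  exact isClosed_iInter fun _ => isClosed_eq (by fun_prop) continuous_const

/-- The equation `z = J E w` in terms of traces: `v j` stands for the derivative of the `j`-th
component of `u`. -/
theorem graphJE_iff (c : Fin 3 → ℝ) (lam : ℝ) (w z : Phase) :
    GraphJE c lam w z ↔ (∀ j, fn (z.fst j) = w.snd j) ∧ ∃ v : Fin 3 → H1Half,
      (∀ j, fn (v j) = der (w.fst j) ∧ z.snd j = c j ^ 2 • der (v j)) ∧
      (∃ κ, (∀ j, c j * trace (v j) = κ) ∧ vertexSum c w.fst = lam * κ) := by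
  unfold GraphJE GraphT DeltaPrime
  refine and_congr_right fun _ => ⟨?_, ?_⟩
  · rintro ⟨⟨u'', hu⟩, a, b, ha, hb, h1, h2, h3⟩
    let v : Fin 3 → H1Half := fun j => ⟨WithLp.toLp 2 (der (w.fst j), u'' j), (hu j).1⟩
    have hb' : ∀ j, b j = trace (v j) := fun j => (hasTrace_fn_iff (v j) _).1 (hb j)
    refine ⟨v, fun j => ⟨rfl, ?_⟩, c 0 * b 0, fun j => ?_, ?_⟩
    · have := (hu j).2
      exact neg_injective this
    · rw [← hb']
      fin_cases j
      · rfl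
      · exact h1.symm
      · exact (h1.trans h2).symm
    · rw [← h3, vertexSum_apply]
      exact Finset.sum_congr rfl fun j _ => by rw [(hasTrace_fn_iff _ _).1 (ha j)]
  · rintro ⟨v, hv, κ, hκ, hs⟩
    refine ⟨⟨fun j => der (v j), fun j => ⟨?_, ?_⟩⟩, fun j => trace (w.fst j),
      fun j => trace (v j), fun j => (hasTrace_fn_iff _ _).2 rfl, fun j => ?_, ?_, ?_, ?_⟩
    · rw [← (hv j).1]
      exact (v j).2
    · rw [← (hv j).2]
      rfl
    · change HasTrace (der (w.fst j)) _
      rw [← (hv j).1]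
      exact (hasTrace_fn_iff _ _).2 rfl
    · rw [hκ, hκ]
    · rw [hκ, hκ]
    · rw [hκ, ← hs, vertexSum_apply]

/-! ### The wave operator in the space of admissible data -/

local instance : NormedSpace ℝ L2Y := PiLp.normedSpace 2 ℝ _

local instance : NormedSpace ℝ Phase := WithLp.instProdNormedSpace 2 ℝ H1Y L2Y

local instance : InnerProductSpace ℝ Phase := WithLp.instProdInnerProductSpace

/-- The space of admissible data `dataSpace c lam` as a Hilbert space in its own right: a type
synonym, on which instance search does not have to unfold the submodule. -/
def Admissible (c : Fin 3 → ℝ) (lam : ℝ) : Type := dataSpace c lam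

instance (c : Fin 3 → ℝ) (lam : ℝ) : NormedAddCommGroup (Admissible c lam) :=
  Submodule.normedAddCommGroup (dataSpace c lam)

instance (c : Fin 3 → ℝ) (lam : ℝ) : InnerProductSpace ℝ (Admissible c lam) :=
  Submodule.innerProductSpace (dataSpace c lam)

instance (c : Fin 3 → ℝ) (lam : ℝ) : CompleteSpace (Admissible c lam) :=
  (isClosed_dataSpace c lam).completeSpace_coe

/-- The inclusion of the space of admissible data into the phase space. -/
def incl (c : Fin 3 → ℝ) (lam : ℝ) : Admissible c lam →L[ℝ] Phase where
  toFun w := (show dataSpace c lam from w).1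
  map_add' _ _ := rfl
  map_smul' _ _ := rfl
  cont := continuous_subtype_val

/-- The identity map of `dataSpace c lam`, as a map into its type synonym. -/
def toAdmissible (c : Fin 3 → ℝ) (lam : ℝ) : dataSpace c lam →L[ℝ] Admissible c lam where
  toFun w := w
  map_add' _ _ := rfl
  map_smul' _ _ := rfl
  cont := continuous_id

variable {c : Fin 3 → ℝ} {lam : ℝ}

theorem incl_mem (w : Admissible c lam) : incl c lam w ∈ dataSpace c lam := w.2

theorem norm_incl (w : Admissible c lam) : ‖incl c lam w‖ = ‖w‖ := rfl

theorem incl_injective : Function.Injective (incl c lam) := Subtype.val_injective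

theorem exists_incl_eq {w : Phase} (hw : w ∈ dataSpace c lam) : ∃ w', incl c lam w' = w :=
  ⟨toAdmissible c lam ⟨w, hw⟩, rfl⟩

/-- The inclusion `H¹(𝒴) → L²(𝒴)`. -/
def fnY : H1Y →L[ℝ] L2Y :=
  ((PiLp.continuousLinearEquiv 2 ℝ (fun _ : Fin 3 => L2Half)).symm :
    (Fin 3 → L2Half) →L[ℝ] L2Y).comp
    (ContinuousLinearMap.pi fun j => fnL.comp (PiLp.proj 2 (fun _ : Fin 3 => H1Half) j))

/-- The embedding `f ↦ (0, f)` of `L²(𝒴)` into the phase space. -/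
def velocity : L2Y →L[ℝ] Phase :=
  ((WithLp.prodContinuousLinearEquiv 2 ℝ H1Y L2Y).symm : (H1Y × L2Y) →L[ℝ] Phase).comp
    (ContinuousLinearMap.inr ℝ H1Y L2Y)

/-- The bounded operator `(u, v) ↦ (0, shift • u)`. -/
def shiftL (c : Fin 3 → ℝ) (lam : ℝ) : Phase →L[ℝ] Phase :=
  shift c lam • velocity.comp (fnY.comp (WithLp.fstL 2 ℝ H1Y L2Y))

theorem shiftL_fst (c : Fin 3 → ℝ) (lam : ℝ) (w : Phase) : (shiftL c lam w).fst = 0 :=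
  smul_zero _

/-- The energy inner product on the space of admissible data. -/
def energy (c : Fin 3 → ℝ) (lam : ℝ) : Admissible c lam →L[ℝ] Admissible c lam →L[ℝ] ℝ :=
  innerForm ((WithLp.sndL 2 ℝ H1Y L2Y).comp (incl c lam)) +
    (ellForm c lam).bilinearComp ((WithLp.fstL 2 ℝ H1Y L2Y).comp (incl c lam))
      ((WithLp.fstL 2 ℝ H1Y L2Y).comp (incl c lam))

theorem energy_apply (w z : Admissible c lam) :
    energy c lam w z = ∑ j, inner ℝ ((incl c lam w).snd j) ((incl c lam z).snd j) +
      ellForm c lam (incl c lam w).fst (incl c lam z).fst := rfl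

/-- The graph of the operator `J E` as a subspace. -/
def graphJE (c : Fin 3 → ℝ) (lam : ℝ) : Submodule ℝ (Phase × Phase) where
  carrier := {p | GraphJE c lam p.1 p.2}
  zero_mem' := by
    simp only [mem_ofPred_eq, graphJE_iff]
    refine ⟨fun j => rfl, fun _ => 0, fun j => ⟨rfl, (smul_zero (c j ^ 2)).symm⟩, 0,
      fun j => by rw [map_zero, mul_zero], ?_⟩
    exact (map_zero _).trans (mul_zero _).symm
  add_mem' := by
    rintro ⟨w, z⟩ ⟨w', z'⟩ hp hq
    simp only [mem_ofPred_eq, graphJE_iff] at hp hq ⊢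
    obtain ⟨hp1, v, hv, κ, hκ, hs⟩ := hp
    obtain ⟨hq1, v', hv', κ', hκ', hs'⟩ := hq
    refine ⟨fun j => congrArg₂ (· + ·) (hp1 j) (hq1 j), fun j => v j + v' j,
      fun j => ⟨congrArg₂ (· + ·) (hv j).1 (hv' j).1, ?_⟩, κ + κ', fun j => ?_, ?_⟩
    · exact (congrArg₂ (· + ·) (hv j).2 (hv' j).2).trans (smul_add (c j ^ 2) _ _).symm
    · rw [map_add, mul_add, hκ, hκ']
    · exact (map_add (vertexSum c) w.fst w'.fst).trans (by rw [hs, hs', mul_add])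
  smul_mem' := by
    rintro r ⟨w, z⟩ hp
    simp only [mem_ofPred_eq, graphJE_iff] at hp ⊢
    obtain ⟨hp1, v, hv, κ, hκ, hs⟩ := hp
    refine ⟨fun j => congrArg (r • ·) (hp1 j), fun j => r • v j,
      fun j => ⟨congrArg (r • ·) (hv j).1, ?_⟩, r * κ, fun j => ?_, ?_⟩
    · exact (congrArg (r • ·) (hv j).2).trans (smul_comm r (c j ^ 2) _)
    · rw [map_smul, smul_eq_mul, mul_left_comm, hκ]
    · exact (map_smul (vertexSum c) r w.fst).trans (by rw [hs, smul_eq_mul, mul_left_comm])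

/-- The graph of the shifted wave operator `(u, v) ↦ (v, -(𝒯 + shift) u)` in the space of
admissible data. -/
def waveGraph (c : Fin 3 → ℝ) (lam : ℝ) : Submodule ℝ (Admissible c lam × Admissible c lam) :=
  (graphJE c lam).comap
    ((LinearMap.fst ℝ Phase Phase).prod
      (LinearMap.snd ℝ Phase Phase + (shiftL c lam).toLinearMap ∘ₗ LinearMap.fst ℝ Phase Phase) ∘ₗ
      (incl c lam).toLinearMap.prodMap (incl c lam).toLinearMap)

theorem mem_waveGraph {p : Admissible c lam × Admissible c lam} :
    p ∈ waveGraph c lam ↔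
      GraphJE c lam (incl c lam p.1) (incl c lam p.2 + shiftL c lam (incl c lam p.1)) := Iff.rfl

/-- Membership in `waveGraph` in terms of traces, as in `graphJE_iff`. -/
theorem mem_waveGraph_iff {p : Admissible c lam × Admissible c lam} :
    p ∈ waveGraph c lam ↔ (∀ j, fn ((incl c lam p.2).fst j) = (incl c lam p.1).snd j) ∧
      ∃ v : Fin 3 → H1Half,
        (∀ j, fn (v j) = der ((incl c lam p.1).fst j) ∧
          (incl c lam p.2).snd j + shift c lam • fn ((incl c lam p.1).fst j) =
            c j ^ 2 • der (v j)) ∧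
        (∃ κ, (∀ j, c j * trace (v j) = κ) ∧ vertexSum c (incl c lam p.1).fst = lam * κ) := by
  have h1 : ∀ j, ((incl c lam p.2) + shiftL c lam (incl c lam p.1)).fst j =
      (incl c lam p.2).fst j := fun j => by
    rw [WithLp.add_fst, shiftL_fst, add_zero]
  have h2 : ∀ j, ((incl c lam p.2) + shiftL c lam (incl c lam p.1)).snd j =
      (incl c lam p.2).snd j + shift c lam • fn ((incl c lam p.1).fst j) := fun j => rfl
  rw [mem_waveGraph, graphJE_iff]
  simp only [h1, h2]

/-- The weak derivative is determined by the function. -/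
theorem fn_injective : Function.Injective fn := by
  intro u w h
  have h1 : HasWeakDeriv (fn w) (der u) := h ▸ u.2
  have h2 : der u = der w := h1.unique w.2
  exact Subtype.ext ((WithLp.ofLp_injective 2) (Prod.ext h h2))

/-- The wave operator is skew-symmetric in the energy inner product: the boundary terms in the
integration by parts cancel the vertex term of the energy. -/
theorem energy_waveGraph {p : Admissible c lam × Admissible c lam}
    (hp : p ∈ waveGraph c lam) : energy c lam p.1 p.2 = 0 := by
  obtain ⟨h1, v, hv, κ, hκ, hs⟩ := mem_waveGraph_iff.1 hp
  have hz := (mem_dataSpace_iff c lam _).1 (incl_mem p.2)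
  rw [energy_apply, ellForm_apply, ← add_assoc, ← Finset.sum_add_distrib]
  have hj : ∀ j, inner ℝ ((incl c lam p.1).snd j) ((incl c lam p.2).snd j) +
      (c j ^ 2 * inner ℝ (der ((incl c lam p.1).fst j)) (der ((incl c lam p.2).fst j)) +
        shift c lam * inner ℝ (fn ((incl c lam p.1).fst j)) (fn ((incl c lam p.2).fst j))) =
      -(κ * (c j * trace ((incl c lam p.2).fst j))) := fun j => by
    have h2 : (incl c lam p.2).snd j = c j ^ 2 • der (v j) -
      shift c lam • fn ((incl c lam p.1).fst j) := eq_sub_of_add_eq (hv j).2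
    have h3 := rep_zero_mul_rep_zero (v j) ((incl c lam p.2).fst j)
    rw [← trace_apply, ← trace_apply] at h3
    rw [h2, ← h1 j, ← (hv j).1, ← hκ j, inner_sub_right, real_inner_smul_right,
      real_inner_smul_right, real_inner_comm (fn ((incl c lam p.1).fst j)),
      real_inner_comm (der (v j))]
    linear_combination (c j ^ 2) * h3
  rw [Finset.sum_congr rfl fun j _ => hj j, Finset.sum_neg_distrib, ← Finset.mul_sum,
    ← vertexSum_apply, hs]
  -- For `lam = 0` the energy has no vertex term, and the boundary terms cancel among themselves.
  by_cases hl : lam = 0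
  · rw [hz hl]
    ring
  · field_simp
    ring

/-! ### The range condition -/

/-- The Lax-Milgram theorem on a closed subspace. -/
theorem exists_lax_milgram {H : Type*} [NormedAddCommGroup H] [InnerProductSpace ℝ H]
    [CompleteSpace H] {b : H →L[ℝ] H →L[ℝ] ℝ} (hb : IsCoercive b) {V : Submodule ℝ H}
    (hV : IsClosed (V : Set H)) (ℓ : H →L[ℝ] ℝ) : ∃ u ∈ V, ∀ φ ∈ V, b u φ = ℓ φ := by
  have : CompleteSpace V := hV.completeSpace_coe
  have hbV : IsCoercive (b.bilinearComp V.subtypeL V.subtypeL) := by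
    obtain ⟨C, hC, h⟩ := hb
    exact ⟨C, hC, fun u => h u⟩
  let g : V := (InnerProductSpace.toDual ℝ V).symm (ℓ.comp V.subtypeL)
  let u : V := hbV.continuousLinearEquivOfBilin.symm g
  refine ⟨u, u.2, fun φ hφ => ?_⟩
  have h1 := hbV.continuousLinearEquivOfBilin_apply u ⟨φ, hφ⟩
  rw [ContinuousLinearEquiv.apply_symm_apply, InnerProductSpace.toDual_symm_apply] at h1
  exact h1.symm

theorem ellForm_symm (u φ : H1Y) : ellForm c lam u φ = ellForm c lam φ u := by
  rw [ellForm_apply, ellForm_apply, mul_comm (vertexSum c u)]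
  refine congrArg (· + _) (Finset.sum_congr rfl fun j _ => ?_)
  rw [real_inner_comm, real_inner_comm (fn (u j))]

theorem exists_trace_eq_one : ∃ e : H1Half, trace e = 1 := by
  let β : ContDiffBump (0 : ℝ) := ⟨1, 2, by norm_num, by norm_num⟩
  obtain ⟨e, -, -, he⟩ := exists_H1Half_of_contDiff (φ := β) β.contDiff β.hasCompactSupport
  exact ⟨e, he.trans (β.one_of_mem_closedBall (Metric.mem_closedBall_self β.rIn_pos.le))⟩

/-- Variational solution of `(1 + ε² (𝒯 + shift)) u = h`. The components `v j` of `u'` turn out to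
be in `H¹` by testing with functions supported off the vertex, and the conditions at the vertex are
the natural boundary conditions of the energy form. -/
theorem exists_elliptic_solution (hc : ∀ j, 0 < c j) (lam : ℝ) {ε : ℝ} (hε : 0 < ε)
    (h : Fin 3 → L2Half) :
    ∃ (u : H1Y) (v : Fin 3 → H1Half), (lam = 0 → vertexSum c u = 0) ∧
      (∀ j, fn (v j) = der (u j) ∧
        fn (u j) + ε ^ 2 • (shift c lam • fn (u j) - c j ^ 2 • der (v j)) = h j) ∧
      ∃ κ, (∀ j, c j * trace (v j) = κ) ∧ vertexSum c u = lam * κ := by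
  obtain ⟨m, hm, -, hell⟩ := ellForm_coercive hc lam
  let A : H1Y →L[ℝ] H1Y →L[ℝ] ℝ := innerForm fnY + ε ^ 2 • ellForm c lam
  have hA : IsCoercive A := by
    refine ⟨ε ^ 2 * m, by positivity, fun u => ?_⟩
    have h1 : 0 ≤ inner ℝ (fnY u) (fnY u) := real_inner_self_nonneg
    have h2 := mul_le_mul_of_nonneg_left (hell u) (sq_nonneg ε)
    change _ ≤ inner ℝ (fnY u) (fnY u) + ε ^ 2 * ellForm c lam u u
    nlinarith
  let V : Submodule ℝ H1Y :=
    { carrier := {u | lam = 0 → vertexSum c u = 0}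
      zero_mem' := fun _ => map_zero _
      add_mem' := fun {a b} ha hb hl => by rw [map_add, ha hl, hb hl, add_zero]
      smul_mem' := fun r a ha hl => by rw [map_smul, ha hl, smul_zero] }
  have hV : IsClosed (V : Set H1Y) := by
    have : (V : Set H1Y) = ⋂ _ : lam = 0, {u | vertexSum c u = 0} := by
      ext u
      simp only [mem_iInter]
      rfl
    rw [this]
    exact isClosed_iInter fun _ => isClosed_eq (vertexSum c).continuous continuous_const
  obtain ⟨u, huV, hu⟩ := exists_lax_milgram hA hV
    ((innerSL ℝ (WithLp.toLp 2 h : L2Y)).comp fnY)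
  have hu' : ∀ φ ∈ V, ∑ j, inner ℝ (fn (u j)) (fn (φ j)) + ε ^ 2 * ellForm c lam u φ =
      ∑ j, inner ℝ (h j) (fn (φ j)) := hu
  have hε2 : ε ^ 2 ≠ 0 := by positivity
  have hcj : ∀ j, c j ^ 2 ≠ 0 := fun j => (pow_pos (hc j) 2).ne'
  -- The value that the equation prescribes for the second derivative.
  let k : Fin 3 → L2Half := fun j =>
    (c j ^ 2)⁻¹ • (shift c lam • fn (u j) - (ε ^ 2)⁻¹ • (h j - fn (u j)))
  have hk : ∀ j, fn (u j) + ε ^ 2 • (shift c lam • fn (u j) - c j ^ 2 • k j) = h j := fun j => by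
    simp only [k]
    rw [smul_inv_smul₀ (hcj j), sub_sub_cancel, smul_inv_smul₀ hε2, add_sub_cancel]
  have hweak : ∀ φ ∈ V, ∑ j, c j ^ 2 * (inner ℝ (der (u j)) (der (φ j)) +
      inner ℝ (k j) (fn (φ j))) + lam⁻¹ * (vertexSum c u * vertexSum c φ) = 0 := fun φ hφ => by
    have h1 := hu' φ hφ
    have h2 : ∀ j, inner ℝ (h j) (fn (φ j)) = inner ℝ (fn (u j)) (fn (φ j)) +
        ε ^ 2 * (shift c lam * inner ℝ (fn (u j)) (fn (φ j)) -
          c j ^ 2 * inner ℝ (k j) (fn (φ j))) := fun j => by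
      rw [← hk j, inner_add_left, real_inner_smul_left, inner_sub_left, real_inner_smul_left,
        real_inner_smul_left]
    simp only [h2] at h1
    rw [Finset.sum_add_distrib, add_right_inj, ← Finset.mul_sum] at h1
    have h3 := mul_left_cancel₀ hε2 h1
    rw [ellForm_apply, Finset.sum_add_distrib, Finset.sum_sub_distrib] at h3
    simp only [mul_add, Finset.sum_add_distrib]
    linarith
  have hder : ∀ j, HasWeakDeriv (der (u j)) (k j) := fun j => by
    refine (hasWeakDeriv_iff _ _).2 fun ψ hψ => ?_
    obtain ⟨e, he1, he2, he3⟩ := exists_H1Half_of_contDiff hψ.1 hψ.2.1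
    have hf : fn e = hψ.memLp.toLp ψ := Lp.ext (he1.trans hψ.memLp.coeFn_toLp.symm)
    have hd : der e = hψ.memLp_deriv.toLp (deriv ψ) :=
      Lp.ext (he2.trans hψ.memLp_deriv.coeFn_toLp.symm)
    have ht : trace e = 0 := he3.trans (hψ.eq_zero self_notMem_Ioi)
    let φ : H1Y := WithLp.toLp 2 fun i => if i = j then e else 0
    have hφj : φ j = e := if_pos rfl
    have hφi : ∀ i, i ≠ j → φ i = 0 := fun i hi => if_neg hi
    have hφt : vertexSum c φ = 0 := by
      rw [vertexSum_apply]
      refine Finset.sum_eq_zero fun i _ => ?_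
      by_cases hi : i = j
      · rw [hi, hφj, ht, mul_zero]
      · rw [hφi i hi, map_zero, mul_zero]
    have h1 := hweak φ fun _ => hφt
    rw [hφt, mul_zero, mul_zero, add_zero, Finset.sum_eq_single j (fun i _ hi => ?_)
      (fun hj => absurd (Finset.mem_univ j) hj), hφj] at h1
    · have h2 := (mul_eq_zero.1 h1).resolve_left (hcj j)
      rw [← hf, ← hd, real_inner_comm, real_inner_comm (k j)]
      exact h2
    · rw [hφi i hi]
      change c i ^ 2 * (inner ℝ (der (u i)) (0 : L2Half) + inner ℝ (k i) (0 : L2Half)) = 0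
      rw [inner_zero_right, inner_zero_right, add_zero, mul_zero]
  let v : Fin 3 → H1Half := fun j => ⟨WithLp.toLp 2 (der (u j), k j), hder j⟩
  refine ⟨u, v, huV, fun j => ⟨rfl, hk j⟩, ?_⟩
  obtain ⟨e, he⟩ := exists_trace_eq_one
  -- Testing with functions with prescribed values `a j` at the vertex.
  have htest : ∀ a : Fin 3 → ℝ, (lam = 0 → ∑ j, c j * a j = 0) →
      ∑ j, c j ^ 2 * trace (v j) * a j = lam⁻¹ * (vertexSum c u * ∑ j, c j * a j) := fun a ha => by
    let φ : H1Y := WithLp.toLp 2 fun j => a j • e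
    have hφt : ∀ j, trace (φ j) = a j := fun j => by
      change trace (a j • e) = a j
      rw [map_smul, he, smul_eq_mul, mul_one]
    have hφs : vertexSum c φ = ∑ j, c j * a j := by
      rw [vertexSum_apply]
      exact Finset.sum_congr rfl fun j _ => by rw [hφt]
    have h1 := hweak φ fun hl => hφs.trans (ha hl)
    have h2 : ∀ j, c j ^ 2 * (inner ℝ (der (u j)) (der (φ j)) + inner ℝ (k j) (fn (φ j))) =
        -(c j ^ 2 * trace (v j) * a j) := fun j => by
      have h3 := rep_zero_mul_rep_zero (v j) (φ j)
      rw [← trace_apply, ← trace_apply, hφt] at h3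
      have h4 : inner ℝ (der (v j)) (fn (φ j)) + inner ℝ (fn (v j)) (der (φ j)) =
        inner ℝ (der (u j)) (der (φ j)) + inner ℝ (k j) (fn (φ j)) := add_comm _ _
      rw [h4] at h3
      rw [mul_assoc, h3]
      ring
    simp only [h2, Finset.sum_neg_distrib, hφs] at h1
    linarith
  -- For `lam = 0` the vectors `eⱼ / cⱼ - e₀ / c₀` are admissible and span all admissible vectors;
  -- for `lam ≠ 0` the unit vectors are admissible.
  by_cases hl : lam = 0
  · refine ⟨c 0 * trace (v 0), fun j => ?_, by rw [huV hl, hl, zero_mul]⟩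
    have hs : ∑ i, c i * ((if i = j then (c j)⁻¹ else 0) - if i = 0 then (c 0)⁻¹ else 0) = 0 := by
      simp [mul_sub, Finset.sum_sub_distrib, (hc _).ne']
    have h1 := htest (fun i => (if i = j then (c j)⁻¹ else 0) - if i = 0 then (c 0)⁻¹ else 0)
      fun _ => hs
    rw [hs, mul_zero, mul_zero] at h1
    simp only [mul_sub, Finset.sum_sub_distrib, mul_ite, mul_zero, Finset.sum_ite_eq',
      Finset.mem_univ, if_true] at h1
    have h2 : ∀ i, c i ^ 2 * trace (v i) * (c i)⁻¹ = c i * trace (v i) := fun i => by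
      have := (hc i).ne'
      field_simp
    rw [h2, h2] at h1
    linarith
  · refine ⟨lam⁻¹ * vertexSum c u, fun j => ?_, by rw [mul_inv_cancel_left₀ hl]⟩
    have h1 := htest (fun i => if i = j then 1 else 0) fun h0 => absurd h0 hl
    simp only [mul_ite, mul_zero, mul_one, Finset.sum_ite_eq', Finset.mem_univ, if_true] at h1
    have := (hc j).ne'
    refine mul_left_cancel₀ this ?_
    linear_combination h1

theorem Phase.norm_sq (w : Phase) : ‖w‖ ^ 2 = ‖w.fst‖ ^ 2 + ∑ j, ‖w.snd j‖ ^ 2 := by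
  rw [WithLp.prod_norm_sq_eq_of_L2, PiLp.norm_sq_eq_of_L2 _ w.snd]

/-- The shifted wave operator is maximal dissipative in the energy inner product. -/
theorem isMDissipative_waveGraph (hc : ∀ j, 0 < c j) (lam : ℝ) :
    IsMDissipative (energy c lam) (waveGraph c lam) where
  symm w z := by
    rw [energy_apply, energy_apply, ellForm_symm]
    exact congrArg (· + _) (Finset.sum_congr rfl fun j _ => real_inner_comm _ _)
  coercive := by
    obtain ⟨m, hm, hm1, hell⟩ := ellForm_coercive hc lam
    refine ⟨m, hm, fun w => ?_⟩
    rw [energy_apply, mul_assoc, ← pow_two, ← norm_incl, Phase.norm_sq]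
    simp only [real_inner_self_eq_norm_sq]
    have h1 : 0 ≤ ∑ j, ‖(incl c lam w).snd j‖ ^ 2 := Finset.sum_nonneg fun j _ => sq_nonneg _
    nlinarith [hell (incl c lam w).fst]
  dissip p hp := (energy_waveGraph hp).le
  range ε hε z := by
    set f : H1Y := (incl c lam z).fst with hf
    set g : L2Y := (incl c lam z).snd with hg
    obtain ⟨u, v, huV, hv, κ, hκ, hs⟩ := exists_elliptic_solution hc lam hε
      fun j => fn (f j) + ε • g j
    -- The first component of the equation forces the velocity `y = (u - f) / ε`; the second one
    -- then is the elliptic equation for `u`.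
    let y : H1Y := ε⁻¹ • (u - f)
    let q : L2Y := WithLp.toLp 2 fun j => c j ^ 2 • der (v j) - shift c lam • fn (u j)
    obtain ⟨w₁, hw₁⟩ := exists_incl_eq (c := c) (lam := lam) (w := WithLp.toLp 2 (u, fnY y))
      ((mem_dataSpace_iff c lam _).2 huV)
    obtain ⟨w₂, hw₂⟩ := exists_incl_eq (c := c) (lam := lam) (w := WithLp.toLp 2 (y, q))
      ((mem_dataSpace_iff c lam _).2 fun hl => by
        have h1 := (mem_dataSpace_iff c lam _).1 (incl_mem z) hl
        change vertexSum c (ε⁻¹ • (u - f)) = 0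
        rw [map_smul, map_sub, huV hl, h1, sub_zero, smul_zero])
    refine ⟨(w₁, w₂), mem_waveGraph_iff.2 ⟨fun j => ?_, v, fun j => ⟨?_, ?_⟩, κ, hκ, ?_⟩, ?_⟩
    · simp only [hw₁, hw₂]
      rfl
    · simp only [hw₁]
      exact (hv j).1
    · simp only [hw₁, hw₂]
      exact sub_add_cancel _ _
    · simp only [hw₁]
      exact hs
    · refine incl_injective ?_
      rw [map_sub, map_smul, hw₁, hw₂]
      refine WithLp.ofLp_injective 2 (Prod.ext ?_ ?_)
      · change u - ε • (ε⁻¹ • (u - f)) = f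
        rw [smul_inv_smul₀ hε.ne', sub_sub_cancel]
      · refine WithLp.ofLp_injective 2 (funext fun j => ?_)
        change ε⁻¹ • (fn (u j) - fn (f j)) -
          ε • (c j ^ 2 • der (v j) - shift c lam • fn (u j)) = g j
        have h1 := (hv j).2
        have h2 : fn (u j) - fn (f j) = ε • g j -
            ε ^ 2 • (shift c lam • fn (u j) - c j ^ 2 • der (v j)) := by
          rw [sub_eq_sub_iff_add_eq_add, h1, add_comm]
        rw [h2, smul_sub, inv_smul_smul₀ hε.ne', pow_two, mul_smul, inv_smul_smul₀ hε.ne',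
          sub_sub, ← smul_add, sub_add_sub_cancel, sub_self, smul_zero, sub_zero]
  singleValued y hy := by
    obtain ⟨h1, v, hv, -⟩ := mem_waveGraph_iff.1 hy
    refine incl_injective ?_
    rw [map_zero]
    refine WithLp.ofLp_injective 2 (Prod.ext ?_ ?_)
    · refine WithLp.ofLp_injective 2 (funext fun j => fn_injective ?_)
      exact h1 j
    · refine WithLp.ofLp_injective 2 (funext fun j => ?_)
      have hvj : v j = 0 := fn_injective (hv j).1
      have h2 := (hv j).2
      rw [hvj] at h2
      have h3 : (incl c lam y).snd j + shift c lam • (0 : L2Half) = c j ^ 2 • (0 : L2Half) := h2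
      rw [smul_zero, smul_zero, add_zero] at h3
      exact h3

/-! ### Solutions of the sine-Gordon system -/

/-- The superposition operator `u ↦ sin u` from `H¹(𝒴)` to `L²(𝒴)`. -/
def sinY (u : H1Y) : L2Y := WithLp.toLp 2 fun j => sinOp (u j)

theorem contDiff_sinY : ContDiff ℝ 2 sinY :=
  contDiff_piLp' 2 fun j =>
    contDiff_sinOp.comp (PiLp.proj (𝕜 := ℝ) 2 (fun _ : Fin 3 => H1Half) j).contDiff

theorem lipschitzWith_sinY : LipschitzWith 1 sinY := by
  refine LipschitzWith.of_dist_le_mul fun u w => ?_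
  rw [NNReal.coe_one, one_mul, dist_eq_norm, dist_eq_norm]
  refine abs_le_of_sq_le_sq ?_ (norm_nonneg _) |> (le_abs_self _).trans
  rw [H1Y.norm_sq, PiLp.norm_sq_eq_of_L2]
  refine Finset.sum_le_sum fun j _ => ?_
  have h1 : ‖(sinY u - sinY w) j‖ ≤ ‖fn ((u - w) j)‖ := norm_sinOp_sub_le (u j) (w j)
  have h2 := pow_le_pow_left₀ (norm_nonneg _) h1 2
  exact h2.trans (le_add_of_nonneg_right (sq_nonneg _))

theorem continuous_nonlin : Continuous nonlin :=
  velocity.continuous.comp (contDiff_sinY.continuous.comp (WithLp.fstL 2 ℝ H1Y L2Y).continuous).neg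

theorem velocity_mem (f : L2Y) : velocity f ∈ dataSpace c lam :=
  (mem_dataSpace_iff c lam _).2 fun _ => map_zero (vertexSum c)

/-- The embedding `f ↦ (0, f)` of `L²(𝒴)` into the space of admissible data. -/
def velocityA (c : Fin 3 → ℝ) (lam : ℝ) : L2Y →L[ℝ] Admissible c lam where
  toFun f := toAdmissible c lam ⟨velocity f, velocity_mem f⟩
  map_add' f g := incl_injective (map_add velocity f g)
  map_smul' r f := incl_injective (map_smul velocity r f)
  cont := velocity.continuous.subtype_mk _

theorem incl_velocityA (f : L2Y) : incl c lam (velocityA c lam f) = velocity f := rfl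

/-- The displacement of an admissible state. -/
def displacement (c : Fin 3 → ℝ) (lam : ℝ) : Admissible c lam →L[ℝ] H1Y :=
  (WithLp.fstL 2 ℝ H1Y L2Y).comp (incl c lam)

/-- The nonlinearity `(u, v) ↦ (0, -sin u + shift • u)`, in which the second term compensates the
shift in `waveGraph`. -/
def waveNonlin (c : Fin 3 → ℝ) (lam : ℝ) (w : Admissible c lam) : Admissible c lam :=
  velocityA c lam (-sinY (displacement c lam w) + shift c lam • fnY (displacement c lam w))

theorem incl_waveNonlin (w : Admissible c lam) :
    incl c lam (waveNonlin c lam w) = nonlin (incl c lam w) + shiftL c lam (incl c lam w) := by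
  rw [waveNonlin, incl_velocityA, map_add, map_smul]
  rfl

theorem contDiff_waveNonlin : ContDiff ℝ 2 (waveNonlin c lam) :=
  (velocityA c lam).contDiff.comp
    ((contDiff_sinY.comp (displacement c lam).contDiff).neg.add
      ((fnY.comp (displacement c lam)).contDiff.const_smul (shift c lam)))

theorem exists_lipschitzWith_waveNonlin : ∃ L, LipschitzWith L (waveNonlin c lam) :=
  ⟨_, (velocityA c lam).lipschitz.comp
    ((lipschitzWith_sinY.comp (displacement c lam).lipschitz).neg.add
      (shift c lam • fnY.comp (displacement c lam)).lipschitz)⟩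

theorem primitive_comp {Y Z : Type*} [NormedAddCommGroup Y] [NormedSpace ℝ Y] [CompleteSpace Y]
    [NormedAddCommGroup Z] [NormedSpace ℝ Z] [CompleteSpace Z] (A : Y →L[ℝ] Z) {T : ℝ}
    (hT : 0 ≤ T) (t : ℝ) (f : C(Icc (0 : ℝ) T, Y)) :
    primitive hT t ((A : C(Y, Z)).comp f) = A (primitive hT t f) :=
  A.intervalIntegral_comp_comm ((continuous_IccExtend hT f).intervalIntegrable _ _)

/-- Solutions with values in the space of admissible data are the mild solutions of the abstract
semilinear problem. -/
theorem isSolution_iff (hc : ∀ j, 0 < c j) {T : ℝ} (hT : 0 ≤ T) (Φ : Admissible c lam)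
    (w : C(Icc (0 : ℝ) T, Admissible c lam)) :
    IsSolution c lam hT (incl c lam Φ) ((incl c lam : C(Admissible c lam, Phase)).comp w) ↔
      ∀ t : Icc (0 : ℝ) T, (primitive hT t w, w t - Φ - primitive hT t
        ((⟨waveNonlin c lam, contDiff_waveNonlin.continuous⟩ :
          C(Admissible c lam, Admissible c lam)).comp w)) ∈ waveGraph c lam := by
  set W := (incl c lam : C(Admissible c lam, Phase)).comp w with hW
  set N : C(Admissible c lam, Admissible c lam) :=
    ⟨waveNonlin c lam, contDiff_waveNonlin.continuous⟩
  have hN : ∀ t, incl c lam (primitive hT t (N.comp w)) =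
      primitive hT t ((⟨nonlin, continuous_nonlin⟩ : C(Phase, Phase)).comp W) +
        shiftL c lam (incl c lam (primitive hT t w)) := fun t => by
    rw [← primitive_comp, ← primitive_comp, ← primitive_comp, ← map_add]
    refine congrArg _ (ContinuousMap.ext fun s => ?_)
    exact incl_waveNonlin (w s)
  have hG : ∀ t : Icc (0 : ℝ) T, (primitive hT t w, w t - Φ - primitive hT t (N.comp w)) ∈
      waveGraph c lam ↔ GraphJE c lam (primitive hT t W) (W t - incl c lam Φ -
        primitive hT t ((⟨nonlin, continuous_nonlin⟩ : C(Phase, Phase)).comp W)) := fun t => by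
    rw [mem_waveGraph, hW, primitive_comp, map_sub, map_sub, hN, ← sub_sub, sub_add_cancel]
    rfl
  refine ⟨fun h t => (hG t).2 (h.2 t), fun h => ⟨?_, fun t => (hG t).1 (h t)⟩⟩
  have h0 := h ⟨0, left_mem_Icc.2 hT⟩
  have hp : ∀ f : C(Icc (0 : ℝ) T, Admissible c lam), primitive hT (0 : ℝ) f = 0 := fun f => by
    rw [primitive_apply, intervalIntegral.integral_same]
  simp only [hp, sub_zero] at h0
  have h1 := (isMDissipative_waveGraph hc lam).singleValued _ h0
  exact congrArg (incl c lam) (sub_eq_zero.1 h1)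

/-- A solution takes its values in the space of admissible data: its integrals satisfy the vertex
condition since they lie in the domain of `J E`, and that condition is stable under differentiation
in `t`. -/
theorem IsSolution.exists_incl_comp_eq {T : ℝ} (hT : 0 < T) {Φ : Phase}
    {w : C(Icc (0 : ℝ) T, Phase)} (h : IsSolution c lam hT.le Φ w) :
    ∃ w' : C(Icc (0 : ℝ) T, Admissible c lam),
      (incl c lam : C(Admissible c lam, Phase)).comp w' = w := by
  have hmem : ∀ t, w t ∈ dataSpace c lam := by
    refine fun t => (mem_dataSpace_iff c lam _).2 fun hl => ?_
    let τ : Phase →L[ℝ] ℝ := (vertexSum c).comp (WithLp.fstL 2 ℝ H1Y L2Y)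
    let f : ℝ → ℝ := fun s => τ (IccExtend hT.le w s)
    have hf : Continuous f := τ.continuous.comp (continuous_IccExtend hT.le w)
    have hint : ∀ t ∈ Icc (0 : ℝ) T, ∫ s in (0 : ℝ)..t, f s = 0 := fun t ht => by
      have h1 := ((graphJE_iff c lam _ _).1 (h.2 ⟨t, ht⟩)).2
      obtain ⟨v, -, κ, -, hs⟩ := h1
      rw [hl, zero_mul] at hs
      exact (τ.intervalIntegral_comp_comm
        ((continuous_IccExtend hT.le w).intervalIntegrable _ _)).trans hs
    have hzero : EqOn f 0 (Ioo 0 T) := fun t ht => by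
      have h1 : HasDerivAt (fun t => ∫ s in (0 : ℝ)..t, f s) (f t) t :=
        intervalIntegral.integral_hasDerivAt_right (hf.intervalIntegrable _ _)
          (hf.stronglyMeasurableAtFilter _ _) hf.continuousAt
      have h2 : (fun t => ∫ s in (0 : ℝ)..t, f s) =ᶠ[𝓝 t] fun _ => 0 := by
        filter_upwards [Icc_mem_nhds ht.1 ht.2] with s hs
        exact hint s hs
      exact h1.unique ((hasDerivAt_const t (0 : ℝ)).congr_of_eventuallyEq h2)
    have hcl := hzero.closure hf continuous_const
    rw [closure_Ioo hT.ne] at hcl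
    have h3 := hcl t.2
    change τ (IccExtend hT.le w t) = 0 at h3
    rw [IccExtend_val] at h3
    exact h3
  exact ⟨⟨fun t => toAdmissible c lam ⟨w t, hmem t⟩,
    (toAdmissible c lam).continuous.comp (w.continuous.subtype_mk hmem)⟩, rfl⟩

/-- The inclusion of `Admissible` into the phase space, applied pointwise, preserves smoothness. -/
theorem contDiff_incl_comp {K : Type*} [TopologicalSpace K] [CompactSpace K] {n : WithTop ℕ∞}
    {S : Admissible c lam → C(K, Admissible c lam)} (hS : ContDiff ℝ n S) :
    ContDiff ℝ n fun Φ : Admissible c lam => (incl c lam).compLeftContinuous ℝ K (S Φ) :=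
  ((incl c lam).compLeftContinuous ℝ K).contDiff.comp hS

end Junction

end Tricrystal

end

theorem theorem3p2 (c : Fin 3 → ℝ) (hc : ∀ j, 0 < c j) (lam : ℝ)
    (Ψ : Tricrystal.dataSpace c lam) :
    ∃ (T : ℝ) (hT : 0 < T),
      (∃! w : C(Set.Icc (0 : ℝ) T, Tricrystal.Phase),
        Tricrystal.IsSolution c lam hT.le (Ψ : Tricrystal.Phase) w) ∧
      ∀ (T₀ : ℝ) (hT₀ : 0 < T₀), T₀ < T →
        ∃ S : Tricrystal.dataSpace c lam → C(Set.Icc (0 : ℝ) T₀, Tricrystal.Phase),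
          (∀ Φ : Tricrystal.dataSpace c lam,
            Tricrystal.IsSolution c lam hT₀.le (Φ : Tricrystal.Phase) (S Φ) ∧
            ∀ w : C(Set.Icc (0 : ℝ) T₀, Tricrystal.Phase),
              Tricrystal.IsSolution c lam hT₀.le (Φ : Tricrystal.Phase) w → w = S Φ) ∧
          ContDiff ℝ 2 S := by
  obtain ⟨L, hL⟩ := Tricrystal.exists_lipschitzWith_waveNonlin (c := c) (lam := lam)
  obtain ⟨T, hT, hS⟩ := (Tricrystal.isMDissipative_waveGraph hc lam).exists_semilinear_flow hL
    two_ne_zero Tricrystal.contDiff_waveNonlin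
  have key : ∀ (T₀ : ℝ) (hT₀ : 0 < T₀), T₀ ≤ T →
      ∃ S : Tricrystal.dataSpace c lam → C(Set.Icc (0 : ℝ) T₀, Tricrystal.Phase),
        (∀ Φ : Tricrystal.dataSpace c lam,
          Tricrystal.IsSolution c lam hT₀.le (Φ : Tricrystal.Phase) (S Φ) ∧
          ∀ w : C(Set.Icc (0 : ℝ) T₀, Tricrystal.Phase),
            Tricrystal.IsSolution c lam hT₀.le (Φ : Tricrystal.Phase) w → w = S Φ) ∧
        ContDiff ℝ 2 S := by
    intro T₀ hT₀ hle
    obtain ⟨S, hSd, hSw⟩ := hS T₀ hT₀ hle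
    refine ⟨fun Φ => (Tricrystal.incl c lam).compLeftContinuous ℝ (Set.Icc (0 : ℝ) T₀)
      (S (Tricrystal.toAdmissible c lam Φ)), fun Φ => ⟨?_, fun w hw => ?_⟩, ?_⟩
    · exact (Tricrystal.isSolution_iff hc hT₀.le (Tricrystal.toAdmissible c lam Φ) _).2
        ((hSw _ _).2 rfl)
    · obtain ⟨w', rfl⟩ := hw.exists_incl_comp_eq hT₀
      have h1 := (hSw _ _).1
        ((Tricrystal.isSolution_iff hc hT₀.le (Tricrystal.toAdmissible c lam Φ) w').1 hw)
      rw [h1]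
      rfl
    · exact Tricrystal.contDiff_incl_comp hSd
  refine ⟨T, hT, ?_, fun T₀ hT₀ hlt => key T₀ hT₀ hlt.le⟩
  obtain ⟨S, hSΦ, -⟩ := key T hT le_rfl
  exact ⟨S Ψ, (hSΦ Ψ).1, (hSΦ Ψ).2⟩
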